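/- Let $N, M$ be positive integers, let $\mathbb{F}_q$ be a finite field of order $q$, and fix a square root $q^{1/2}\in\mathbb{C}$ of $q$. Let $H$ be a vector space over $\mathbb{F}_q$ of dimension $N+M$ and let $h\subseteq H$ be a subspace of dimension $M$. Let $P=\mathcal{A}_q(N,M)$ be the attenuated space poset, that is, the set of subspaces $x$ of $H$ with $x\cap h=0$, ordered by inclusion; let $P_i$ be the set of elements of $P$ of dimension $i$ $(0\le i\le N)$. In $\mathrm{Mat}_P(\mathbb{C})$ let $L$ be the matrix with $(x,y)$-entry $1$ if $y$ covers $x$ and $0$ otherwise, let $R=L^t$, let $F_i$ be the diagonal matrix with $(y,y)$-entry $1$ if $y\in P_i$ and $0$ otherwise, and let $K=\sum_{i=0}^{N}q^{N+M-i}F_i$. Let $T$ be the subalgebra of $\mathrm{Mat}_P(\mathbb{C})$ generated by $R, L, K, K^{-1}$; it acts semisimply on the space $\mathbb{C}P$ of column vectors. By a $T$-module we mean a $T$-submodule of $\mathbb{C}P$. For an irreducible $T$-module $W$, the endpoint of $W$ is $r=\min\{i : 0\le i\le N,\ F_iW\ne 0\}$ and the diameter of $W$ is $d=|\{i : 0\le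 i\le N,\ F_iW\neq 0\}|-1$; both depend only on the isomorphism class of $W$. Let $\Psi$ be the (finite) set of isomorphism classes $\lambda$ of irreducible $T$-modules, called types, and write $\lambda=(r,d)$ when $\lambda$ has endpoint $r$ and diameter $d$. For $\lambda\in\Psi$ let $V_\lambda\subseteq\mathbb{C}P$ be the span of the irreducible $T$-modules of type $\lambda$, so that $\mathbb{C}P=\bigoplus_{\lambda\in\Psi}V_\lambda$, and let $e_\lambda\in\mathrm{Mat}_P(\mathbb{C})$ be the projection that acts as the identity on $V_\lambda$ and as $0$ on $V_\mu$ for all $\mu\in\Psi$, $\mu\ne\lambda$. Define $$\Phi=\sum_{\lambda=(r,d)\in\Psi}q^{r}e_\lambda,\qquad \Omega=\sum_{\lambda=(r,d)\in\Psi}q^{d/2}e_\lambda,$$ where $q^{d/2}=(q^{1/2})^d$. Then the center $Z(T)$ is generated by $\Phi,\Omega$: the (unital) $\mathbb{C}$-subalgebra of $\mathrm{Mat}_P(\mathbb{C})$ generated by $\Phi$ and $\Omega$ is equal to $Z(T)$. -/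

import Mathlib

/-! ## Irreducible modules of a matrix algebra `T`, their types, and the projections `e_λ` -/

namespace MatrixAlgebra

/-- The irreducible `T`-submodules of the standard module `ℂ^n` (column vectors), for a subalgebra
`T` of `Mat_n(ℂ)`. -/
def IrreducibleModule {n : Type*} [Fintype n] [DecidableEq n]
    (T : Subalgebra ℂ (Matrix n n ℂ)) : Type _ :=
  {W : Submodule T (n → ℂ) // IsSimpleModule T W}

/-- Isomorphism of irreducible `T`-modules. -/
instance irreducibleModuleSetoid {n : Type*} [Fintype n] [DecidableEq n]
    (T : Subalgebra ℂ (Matrix n n ℂ)) : Setoid (IrreducibleModule T) where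
  r W W' := Nonempty (W.1 ≃ₗ[T] W'.1)
  iseqv :=
    { refl := fun _ => ⟨LinearEquiv.refl _ _⟩
      symm := fun ⟨e⟩ => ⟨e.symm⟩
      trans := fun ⟨e⟩ ⟨e'⟩ => ⟨e.trans e'⟩ }

/-- The set `Ψ` of types: isomorphism classes of irreducible `T`-modules. -/
def ModuleType {n : Type*} [Fintype n] [DecidableEq n]
    (T : Subalgebra ℂ (Matrix n n ℂ)) : Type _ :=
  Quotient (irreducibleModuleSetoid T)

/-- `V_λ`: the span of the irreducible `T`-modules of type `λ`. -/
def homogeneousComponent {n : Type*} [Fintype n] [DecidableEq n]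
    (T : Subalgebra ℂ (Matrix n n ℂ)) (l : ModuleType T) : Submodule T (n → ℂ) :=
  sSup {W | ∃ hW : IsSimpleModule T W, (Quotient.mk _ ⟨W, hW⟩ : ModuleType T) = l}

theorem homogeneousComponent_mk {n : Type*} [Fintype n] [DecidableEq n]
    (T : Subalgebra ℂ (Matrix n n ℂ)) (W : IrreducibleModule T) :
    homogeneousComponent T (Quotient.mk _ W) = isotypicComponent T (n → ℂ) W.1 := by
  unfold homogeneousComponent isotypicComponent
  congr 1
  ext W'
  constructor
  · rintro ⟨hW', h⟩
    exact Quotient.exact h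
  · rintro ⟨e⟩
    have := W.2
    exact ⟨IsSimpleModule.congr (N := W.1) e, Quotient.sound ⟨e⟩⟩

theorem homogeneousComponent_mem {n : Type*} [Fintype n] [DecidableEq n]
    (T : Subalgebra ℂ (Matrix n n ℂ)) (l : ModuleType T) :
    homogeneousComponent T l ∈ isotypicComponents T (n → ℂ) := by
  induction l using Quotient.inductionOn with
  | h W => exact ⟨W.1, W.2, homogeneousComponent_mk T W⟩

theorem homogeneousComponent_injective {n : Type*} [Fintype n] [DecidableEq n]
    (T : Subalgebra ℂ (Matrix n n ℂ)) : Function.Injective (homogeneousComponent T) := by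
  intro l l' h
  induction l using Quotient.inductionOn with
  | h W =>
    induction l' using Quotient.inductionOn with
    | h W' =>
      have := W.2
      have := W'.2
      rw [homogeneousComponent_mk, homogeneousComponent_mk] at h
      exact Quotient.sound (isIsotypicOfType_submodule_iff.mp
        (IsIsotypicOfType.isotypicComponent T (n → ℂ) W'.1) W.1
        (h ▸ W.1.le_isotypicComponent))

instance moduleType_finite {n : Type*} [Fintype n] [DecidableEq n]
    (T : Subalgebra ℂ (Matrix n n ℂ)) : Finite (ModuleType T) := by
  have : IsNoetherian T (n → ℂ) := isNoetherian_of_tower ℂ inferInstance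
  exact Finite.of_injective
    (fun l => (⟨_, homogeneousComponent_mem T l⟩ : isotypicComponents T (n → ℂ)))
    (fun _ _ h => homogeneousComponent_injective T (congrArg Subtype.val h))

noncomputable instance moduleType_fintype {n : Type*} [Fintype n] [DecidableEq n]
    (T : Subalgebra ℂ (Matrix n n ℂ)) : Fintype (ModuleType T) :=
  Fintype.ofFinite _

/-- If `ℂ^n` is a semisimple `T`-module, then it is the direct sum of the `V_λ`. -/
theorem isCompl_homogeneousComponent {n : Type*} [Fintype n] [DecidableEq n]
    (T : Subalgebra ℂ (Matrix n n ℂ)) [IsSemisimpleModule T (n → ℂ)] (l : ModuleType T) :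
    IsCompl (homogeneousComponent T l) (⨆ m, ⨆ _ : m ≠ l, homogeneousComponent T m) := by
  constructor
  · refine (sSupIndep_isotypicComponents T (n → ℂ) (homogeneousComponent_mem T l)).mono_right ?_
    exact iSup₂_le fun m hm => le_sSup
      ⟨homogeneousComponent_mem T m, fun h => hm (homogeneousComponent_injective T h)⟩
  · rw [codisjoint_iff_le_sup, ← sSup_isotypicComponents T (n → ℂ)]
    refine sSup_le ?_
    rintro _ ⟨S, hS, rfl⟩
    rw [← homogeneousComponent_mk T ⟨S, hS⟩]
    by_cases h : (Quotient.mk _ ⟨S, hS⟩ : ModuleType T) = l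
    · rw [h]
      exact le_sup_left
    · exact le_sup_of_le_right (le_iSup₂_of_le _ h le_rfl)

/-- `e_λ`: the matrix of the linear map `ℂ^n → ℂ^n` that is the identity on `V_λ` and zero on
`V_μ` for every type `μ ≠ λ`. -/
noncomputable def primitiveIdempotent {n : Type*} [Fintype n] [DecidableEq n]
    (T : Subalgebra ℂ (Matrix n n ℂ)) [IsSemisimpleModule T (n → ℂ)] (l : ModuleType T) :
    Matrix n n ℂ :=
  LinearMap.toMatrix' ((Submodule.projection _ _ (isCompl_homogeneousComponent T l)).restrictScalars ℂ)

theorem primitiveIdempotent_mulVec_of_mem {n : Type*} [Fintype n] [DecidableEq n]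
    (T : Subalgebra ℂ (Matrix n n ℂ)) [IsSemisimpleModule T (n → ℂ)] (l : ModuleType T)
    (v : n → ℂ) (hv : v ∈ homogeneousComponent T l) :
    (primitiveIdempotent T l).mulVec v = v := by
  rw [primitiveIdempotent, LinearMap.toMatrix'_mulVec]
  exact Submodule.projection_apply_left (isCompl_homogeneousComponent T l) ⟨v, hv⟩

theorem primitiveIdempotent_mulVec_of_ne {n : Type*} [Fintype n] [DecidableEq n]
    (T : Subalgebra ℂ (Matrix n n ℂ)) [IsSemisimpleModule T (n → ℂ)] (l m : ModuleType T)
    (hm : m ≠ l) (v : n → ℂ) (hv : v ∈ homogeneousComponent T m) :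
    (primitiveIdempotent T l).mulVec v = 0 := by
  rw [primitiveIdempotent, LinearMap.toMatrix'_mulVec]
  exact (Submodule.projection_apply_eq_zero_iff (isCompl_homogeneousComponent T l)).mpr
    ((le_iSup₂_of_le (f := fun m (_ : m ≠ l) => homogeneousComponent T m) m hm le_rfl) hv)

/-- A matrix algebra generated by a set that is closed under conjugate transpose acts
semisimply. -/
theorem isSemisimpleModule_adjoin {n : Type*} [Fintype n] [DecidableEq n]
    (s : Set (Matrix n n ℂ)) (hs : ∀ A ∈ s, A.conjTranspose ∈ s) :
    IsSemisimpleModule (Algebra.adjoin ℂ s) (n → ℂ) := by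
  have hstar : ∀ A ∈ Algebra.adjoin ℂ s, A.conjTranspose ∈ Algebra.adjoin ℂ s := by
    intro A hA
    induction hA using Algebra.adjoin_induction with
    | mem x hx => exact Algebra.subset_adjoin (hs x hx)
    | algebraMap r =>
      have : ((algebraMap ℂ (Matrix n n ℂ)) r).conjTranspose
          = algebraMap ℂ (Matrix n n ℂ) (star r) := by
        rw [← Matrix.star_eq_conjTranspose, algebraMap_star_comm]
      rw [this]
      exact Subalgebra.algebraMap_mem _ _
    | add x y _ _ hx hy =>
      rw [Matrix.conjTranspose_add]
      exact add_mem hx hy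
    | mul x y _ _ hx hy =>
      rw [Matrix.conjTranspose_mul]
      exact mul_mem hy hx
  rw [isSemisimpleModule_iff]
  refine ⟨fun W => ?_⟩
  let U : Submodule (Algebra.adjoin ℂ s) (n → ℂ) :=
    { carrier := {v | ∀ w ∈ W, star w ⬝ᵥ v = 0}
      add_mem' := fun {a b} ha hb w hw => by
        rw [dotProduct_add, ha w hw, hb w hw, add_zero]
      zero_mem' := fun w _ => dotProduct_zero _
      smul_mem' := fun A v hv w hw => by
        have h1 := hv _ (W.smul_mem ⟨_, hstar A.1 A.2⟩ hw)
        have h2 : star ((⟨_, hstar A.1 A.2⟩ : Algebra.adjoin ℂ s) • w) ⬝ᵥ v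
            = star w ⬝ᵥ (A • v) := by
          change star (A.1.conjTranspose.mulVec w) ⬝ᵥ v = star w ⬝ᵥ (A.1.mulVec v)
          rw [Matrix.star_mulVec, Matrix.conjTranspose_conjTranspose, Matrix.dotProduct_mulVec]
        rw [← h2]
        exact h1 }
  refine ⟨U, ?_, ?_⟩
  · rw [Submodule.disjoint_def]
    intro x hx hU
    open scoped ComplexOrder in
    exact dotProduct_star_self_eq_zero.mp (hU x hx)
  · rw [codisjoint_iff, eq_top_iff]
    intro v _
    let E := WithLp.linearEquiv 2 ℂ (n → ℂ)
    let W0 : Submodule ℂ (EuclideanSpace ℂ n) := (W.restrictScalars ℂ).comap E.toLinearMap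
    obtain ⟨y, hy, z, hz, hyz⟩ := W0.exists_add_mem_mem_orthogonal (E.symm v)
    refine Submodule.mem_sup.mpr ⟨E y, hy, E z, ?_, ?_⟩
    · intro w hw
      have := (Submodule.mem_orthogonal W0 z).mp hz (E.symm w) hw
      rw [EuclideanSpace.inner_eq_star_dotProduct] at this
      rw [dotProduct_comm]
      exact this
    · rw [← map_add, ← hyz, LinearEquiv.apply_symm_apply]

theorem smul_eq_zero_of_equiv {A V : Type*} [Ring A] [AddCommGroup V] [Module A V]
    (W W' : Submodule A V) (e : W ≃ₗ[A] W') (a : A) (w : W) (h : a • (e w : V) = 0) :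
    a • (w : V) = 0 := by
  have h1 : e (a • w) = 0 := (e.map_smul a w).trans (Subtype.ext h)
  rw [LinearEquiv.map_eq_zero_iff] at h1
  exact congrArg Subtype.val h1

end MatrixAlgebra

/-! ## The attenuated space poset and its incidence algebra -/

/-- The set of subspaces of `H` whose intersection with `h` is zero. -/
def AttenuatedSpace {F H : Type*} [Field F] [AddCommGroup H] [Module F H]
    (h : Submodule F H) : Type _ :=
  {x : Submodule F H // x ⊓ h = ⊥}

namespace AttenuatedSpace

/-- The partial order is inclusion. -/
instance instPartialOrder {F H : Type*} [Field F] [AddCommGroup H] [Module F H]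
    (h : Submodule F H) : PartialOrder (AttenuatedSpace h) :=
  inferInstanceAs (PartialOrder {x : Submodule F H // x ⊓ h = ⊥})

noncomputable instance instFintype {F H : Type*} [Field F] [Finite F] [AddCommGroup H] [Module F H]
    [FiniteDimensional F H] (h : Submodule F H) : Fintype (AttenuatedSpace h) :=
  have : Finite H := Module.finite_of_finite F
  have : Finite (AttenuatedSpace h) :=
    inferInstanceAs (Finite {x : Submodule F H // x ⊓ h = ⊥})
  Fintype.ofFinite _

noncomputable instance instDecidableEq {F H : Type*} [Field F] [AddCommGroup H] [Module F H]
    (h : Submodule F H) : DecidableEq (AttenuatedSpace h) :=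
  Classical.decEq _

/-- The dimension of an element of the poset. -/
noncomputable def dim {F H : Type*} [Field F] [AddCommGroup H] [Module F H]
    {h : Submodule F H} (x : AttenuatedSpace h) : ℕ :=
  Module.finrank F x.1

open Classical in
/-- The lowering matrix `L`. -/
noncomputable def lowering {F H : Type*} [Field F] [AddCommGroup H] [Module F H]
    (h : Submodule F H) : Matrix (AttenuatedSpace h) (AttenuatedSpace h) ℂ :=
  Matrix.of fun x y => if x ⋖ y then 1 else 0

open Classical in
/-- The raising matrix `R`. -/
noncomputable def raising {F H : Type*} [Field F] [AddCommGroup H] [Module F H]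
    (h : Submodule F H) : Matrix (AttenuatedSpace h) (AttenuatedSpace h) ℂ :=
  Matrix.of fun x y => if y ⋖ x then 1 else 0

/-- The `i`th projection matrix `F_i`. -/
noncomputable def proj {F H : Type*} [Field F] [AddCommGroup H] [Module F H]
    (h : Submodule F H) (i : ℕ) : Matrix (AttenuatedSpace h) (AttenuatedSpace h) ℂ :=
  Matrix.diagonal fun y => if dim y = i then 1 else 0

/-- The matrix `K = ∑_{i=0}^N q^{N+M-i} F_i`, with `q = |F|`. -/
noncomputable def matK {F H : Type*} [Field F] [AddCommGroup H] [Module F H]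
    (h : Submodule F H) (N M : ℕ) : Matrix (AttenuatedSpace h) (AttenuatedSpace h) ℂ :=
  ∑ i ∈ Finset.range (N + 1), (Nat.card F : ℂ) ^ ((N : ℤ) + M - i) • proj h i

/-- The incidence algebra `T`, the subalgebra of `Mat_P(ℂ)` generated by `R, L, K, K⁻¹`. -/
noncomputable def incidenceAlgebra {F H : Type*} [Field F] [Finite F] [AddCommGroup H]
    [Module F H] [FiniteDimensional F H] (h : Submodule F H) (N M : ℕ) :
    Subalgebra ℂ (Matrix (AttenuatedSpace h) (AttenuatedSpace h) ℂ) :=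
  Algebra.adjoin ℂ {raising h, lowering h, matK h N M, (matK h N M)⁻¹}

theorem matK_eq_diagonal {F H : Type*} [Field F] [AddCommGroup H] [Module F H]
    (h : Submodule F H) (N M : ℕ) :
    matK h N M = Matrix.diagonal fun y =>
      if dim y ≤ N then (Nat.card F : ℂ) ^ ((N : ℤ) + M - dim y) else 0 := by
  ext x y
  rw [matK, Matrix.sum_apply]
  by_cases hxy : x = y
  · subst hxy
    simp [proj]
  · simp [proj, hxy]

instance isSemisimpleModule {F H : Type*} [Field F] [Finite F] [AddCommGroup H]
    [Module F H] [FiniteDimensional F H] (h : Submodule F H) (N M : ℕ) :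
    IsSemisimpleModule (incidenceAlgebra h N M) (AttenuatedSpace h → ℂ) := by
  have hR : (raising h).conjTranspose = lowering h := by
    ext x y
    simp only [raising, lowering, Matrix.conjTranspose_apply, Matrix.of_apply]
    split_ifs <;> simp
  have hL : (lowering h).conjTranspose = raising h := by
    rw [← hR, Matrix.conjTranspose_conjTranspose]
  have hK : (matK h N M).conjTranspose = matK h N M := by
    rw [matK_eq_diagonal, Matrix.diagonal_conjTranspose]
    congr 1
    ext y
    simp only [Pi.star_apply]
    split_ifs <;> simp
  refine MatrixAlgebra.isSemisimpleModule_adjoin _ ?_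
  rintro A (rfl | rfl | rfl | rfl)
  · rw [hR]; simp
  · rw [hL]; simp
  · rw [hK]; simp
  · rw [Matrix.conjTranspose_nonsing_inv, hK]; simp

/-- The set `{i | 0 ≤ i ≤ N, F_i W ≠ 0}`. -/
def support {F H : Type*} [Field F] [Finite F] [AddCommGroup H] [Module F H]
    [FiniteDimensional F H] (h : Submodule F H) (N M : ℕ)
    (W : Submodule (incidenceAlgebra h N M) (AttenuatedSpace h → ℂ)) : Set ℕ :=
  {i | i ≤ N ∧ ∃ w ∈ W, (proj h i).mulVec w ≠ 0}

theorem proj_mem_incidenceAlgebra {F H : Type*} [Field F] [Finite F] [AddCommGroup H] [Module F H]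
    [FiniteDimensional F H] (h : Submodule F H) (N M i : ℕ) (hi : i ≤ N) :
    proj h i ∈ incidenceAlgebra h N M := by
  classical
  have hq : 1 < (Nat.card F : ℝ) := by exact_mod_cast Finite.one_lt_card
  have hq0 : (Nat.card F : ℂ) ≠ 0 := by exact_mod_cast Nat.card_pos.ne'
  have hinj : ∀ a b : ℤ, (Nat.card F : ℂ) ^ a = (Nat.card F : ℂ) ^ b → a = b := by
    intro a b hab
    have : (Nat.card F : ℝ) ^ a = (Nat.card F : ℝ) ^ b := by
      apply Complex.ofReal_injective
      push_cast
      exact hab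
    exact zpow_right_injective₀ (by linarith) hq.ne' this
  set d : AttenuatedSpace h → ℂ := fun y =>
    if dim y ≤ N then (Nat.card F : ℂ) ^ ((N : ℤ) + M - dim y) else 0 with hd
  let p : Polynomial ℂ := Lagrange.interpolate (Finset.univ.image d) id
    (fun c => if c = (Nat.card F : ℂ) ^ ((N : ℤ) + M - i) then 1 else 0)
  have key : proj h i = Polynomial.aeval (matK h N M) p := by
    have hdiag : Polynomial.aeval (matK h N M) p
        = Matrix.diagonal (fun y => p.eval (d y)) := by
      rw [matK_eq_diagonal]
      have := Polynomial.aeval_algHom_apply (Matrix.diagonalAlgHom (n := AttenuatedSpace h) ℂ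
        (α := ℂ)) d p
      rw [Matrix.diagonalAlgHom_apply] at this
      rw [← hd, this, Matrix.diagonalAlgHom_apply]
      congr 1
      ext y
      rw [Polynomial.aeval_pi_apply₂, Polynomial.coe_aeval_eq_eval]
    rw [hdiag, proj]
    congr 1
    ext y
    have h1 : p.eval (d y) = if d y = (Nat.card F : ℂ) ^ ((N : ℤ) + M - i) then 1 else 0 :=
      Lagrange.eval_interpolate_at_node (v := id) _ Function.injective_id.injOn
        (Finset.mem_image_of_mem d (Finset.mem_univ y))
    rw [h1]
    refine if_congr ?_ rfl rfl
    simp only [hd]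
    constructor
    · intro hy
      rw [hy, if_pos hi]
    · intro hy
      split_ifs at hy with hN
      · have := hinj _ _ hy
        omega
      · exact absurd hy.symm (zpow_ne_zero _ hq0)
  rw [key]
  have hK : matK h N M ∈ incidenceAlgebra h N M := Algebra.subset_adjoin (by simp)
  exact Algebra.adjoin_le (Set.singleton_subset_iff.mpr hK)
    (Polynomial.aeval_mem_adjoin_singleton ℂ _)

theorem support_subset_of_equiv {F H : Type*} [Field F] [Finite F] [AddCommGroup H] [Module F H]
    [FiniteDimensional F H] (h : Submodule F H) (N M : ℕ)
    (W W' : Submodule (incidenceAlgebra h N M) (AttenuatedSpace h → ℂ))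
    (e : W ≃ₗ[incidenceAlgebra h N M] W') : support h N M W ⊆ support h N M W' := by
  rintro i ⟨hi, w, hw, hne⟩
  refine ⟨hi, e ⟨w, hw⟩, (e ⟨w, hw⟩).2, fun h0 => hne ?_⟩
  exact MatrixAlgebra.smul_eq_zero_of_equiv W W' e
    ⟨proj h i, proj_mem_incidenceAlgebra h N M i hi⟩ ⟨w, hw⟩ h0

theorem support_eq_of_equiv {F H : Type*} [Field F] [Finite F] [AddCommGroup H] [Module F H]
    [FiniteDimensional F H] (h : Submodule F H) (N M : ℕ)
    (W W' : Submodule (incidenceAlgebra h N M) (AttenuatedSpace h → ℂ))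
    (e : W ≃ₗ[incidenceAlgebra h N M] W') : support h N M W = support h N M W' :=
  (support_subset_of_equiv h N M W W' e).antisymm (support_subset_of_equiv h N M W' W e.symm)

/-- The endpoint `r` of a type: the common value of `min {i | F_i W ≠ 0}` on the irreducible
modules `W` of that type. -/
noncomputable def endpoint {F H : Type*} [Field F] [Finite F] [AddCommGroup H] [Module F H]
    [FiniteDimensional F H] (h : Submodule F H) (N M : ℕ)
    (l : MatrixAlgebra.ModuleType (incidenceAlgebra h N M)) : ℕ :=
  Quotient.lift (fun W => sInf (support h N M W.1))
    (fun W W' (hW : Nonempty (W.1 ≃ₗ[incidenceAlgebra h N M] W'.1)) =>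
      congrArg sInf
      (hW.elim fun e => support_eq_of_equiv h N M W.1 W'.1 e)) l

/-- The diameter `d` of a type: the common value of `|{i | F_i W ≠ 0}| - 1` on the irreducible
modules `W` of that type. -/
noncomputable def diameter {F H : Type*} [Field F] [Finite F] [AddCommGroup H] [Module F H]
    [FiniteDimensional F H] (h : Submodule F H) (N M : ℕ)
    (l : MatrixAlgebra.ModuleType (incidenceAlgebra h N M)) : ℕ :=
  Quotient.lift (fun W => (support h N M W.1).ncard - 1)
    (fun W W' (hW : Nonempty (W.1 ≃ₗ[incidenceAlgebra h N M] W'.1)) =>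
      congrArg (fun s => Set.ncard s - 1)
      (hW.elim fun e => support_eq_of_equiv h N M W.1 W'.1 e)) l

/-- `Φ = ∑_λ q^r e_λ`, the sum over the types `λ` with endpoint `r` and diameter `d`. -/
noncomputable def Phi {F H : Type*} [Field F] [Finite F] [AddCommGroup H] [Module F H]
    [FiniteDimensional F H] (h : Submodule F H) (N M : ℕ) :
    Matrix (AttenuatedSpace h) (AttenuatedSpace h) ℂ :=
  ∑ l : MatrixAlgebra.ModuleType (incidenceAlgebra h N M),
    (Nat.card F : ℂ) ^ endpoint h N M l • MatrixAlgebra.primitiveIdempotent _ l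

/-- `Ω = ∑_λ q^{d/2} e_λ`, the sum over the types `λ` with endpoint `r` and diameter `d`, where
`s = q^{1/2}` is the chosen square root of `q` and `q^{d/2}` is `s^d`. -/
noncomputable def Omega {F H : Type*} [Field F] [Finite F] [AddCommGroup H] [Module F H]
    [FiniteDimensional F H] (h : Submodule F H) (N M : ℕ) (s : ℂ) :
    Matrix (AttenuatedSpace h) (AttenuatedSpace h) ℂ :=
  ∑ l : MatrixAlgebra.ModuleType (incidenceAlgebra h N M),
    s ^ diameter h N M l • MatrixAlgebra.primitiveIdempotent _ l

end AttenuatedSpace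

/-! The center. `ℂ^P` is a semisimple `T`-module, so by the double centralizer property every `e_λ`
lies in `T`, and by Schur's lemma a central element is a scalar on each `V_λ`. Hence `Z(T)` is the
image of the algebra of functions on the finite set of types (`range_scalarHom`). Interpolation
shows that two functions generate this algebra as soon as they jointly separate points
(`adjoin_pair_eq_top`). Since `q > 1`, the scalar `q^r` determines `r`, and the square of `q^{d/2}`
determines `d`. So everything reduces to one claim: a type is determined by its endpoint and
diameter (`moduleType_ext`).

The claim rests on the cubic relation `q R L² + L² R + (q+1) L K = (q+1) L R L`
(`lowering_raising_relation`), proved entry by entry by counting subspaces. In an irreducible module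
with endpoint `r`, choose an eigenvector `v` of `L R` in degree `r`, with eigenvalue `x`. The
transposed relation gives `L R^(i+1) v = x_(i+1) R^i v`, where the `x_i` obey a second-order
recurrence depending only on `q`, `N + M - r` and `x`. Thus `v, R v, ..., R^d v` span the module,
and the action of `T` on them is fixed by `r`, `d` and `x`.

Finally `x` is itself determined by `r` and `d`: from `R^(d+1) v = 0` and `R^d v ≠ 0` one gets
`x_(d+1) = 0`, and `x_(d+1)` is affine in `x` with slope `1 + q + ... + q^d ≠ 0`
(`IsLowestVector.eigenvalue_unique`). Equal data then give equal annihilators of the two generators,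
hence isomorphic modules. -/

namespace MatrixAlgebra

/-! ### The center of a semisimple matrix algebra -/

/-- The double centralizer property: a linear map that commutes with every `T`-endomorphism of the
semisimple `T`-module `ℂ^n` is the action of an element of `T`. -/
theorem toMatrix'_mem_of_commute {n : Type*} [Fintype n] [DecidableEq n]
    (T : Subalgebra ℂ (Matrix n n ℂ)) [IsSemisimpleModule T (n → ℂ)]
    (f : (n → ℂ) →ₗ[ℂ] (n → ℂ)) (hf : ∀ (g : (n → ℂ) →ₗ[T] (n → ℂ)) v, f (g v) = g (f v)) :
    LinearMap.toMatrix' f ∈ T := by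
  -- `b` is the tuple of all standard basis vectors, so an element of `T` is determined by its
  -- action on `b`. It suffices to find `a` in `T` with `f b = a b`, that is, to show that `f`,
  -- applied coordinatewise, preserves the submodule `T b`.
  let b : n → n → ℂ := fun j => Pi.single j 1
  obtain ⟨U, hU⟩ := exists_isCompl (Submodule.span T {b})
  let p := Submodule.projection _ _ hU
  -- The projection `p` onto `T b` is a matrix of `T`-endomorphisms of `ℂ^n`, and `f` commutes with
  -- each entry.
  have hfp : ∀ w : n → n → ℂ, p (fun j => f (w j)) = fun j => f (p w j) := by
    intro w
    have hw : ∀ w : n → n → ℂ, p w = fun k => ∑ j, p (Pi.single j (w j)) k := by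
      intro w
      conv_lhs => rw [← Finset.univ_sum_single w, map_sum]
      ext k
      simp
    rw [hw, hw w]
    ext1 k
    rw [map_sum]
    refine Finset.sum_congr rfl fun j _ => ?_
    exact (hf ((LinearMap.proj k).comp (p.comp (LinearMap.single T (fun _ => n → ℂ) j))) (w j)).symm
  have hb : p b = b :=
    Submodule.projection_apply_left hU ⟨b, Submodule.mem_span_singleton_self b⟩
  have hmem : (fun j => f (b j)) ∈ Submodule.span T {b} := by
    have h1 := hfp b
    rw [hb] at h1
    rw [← h1]
    exact Submodule.projection_apply_mem hU _
  obtain ⟨a, ha⟩ := Submodule.mem_span_singleton.mp hmem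
  have : LinearMap.toMatrix' f = a.1 := by
    ext i j
    rw [LinearMap.toMatrix'_apply]
    have h2 : a.1.mulVec (b j) = f (b j) := congrFun ha j
    have h3 : (Pi.single j 1 : n → ℂ) = b j := rfl
    rw [h3, ← h2]
    simp [b]
  rw [this]
  exact a.2

theorem iSup_homogeneousComponent {n : Type*} [Fintype n] [DecidableEq n]
    (T : Subalgebra ℂ (Matrix n n ℂ)) [IsSemisimpleModule T (n → ℂ)] :
    ⨆ l, homogeneousComponent T l = ⊤ := by
  rw [eq_top_iff, ← sSup_isotypicComponents T (n → ℂ)]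
  refine sSup_le ?_
  rintro _ ⟨S, hS, rfl⟩
  rw [← homogeneousComponent_mk T ⟨S, hS⟩]
  exact le_iSup (homogeneousComponent T) _

/-- Two matrices that agree on every homogeneous component are equal. -/
theorem ext_of_homogeneousComponent {n : Type*} [Fintype n] [DecidableEq n]
    (T : Subalgebra ℂ (Matrix n n ℂ)) [IsSemisimpleModule T (n → ℂ)] (A B : Matrix n n ℂ)
    (h : ∀ l, ∀ v ∈ homogeneousComponent T l, A.mulVec v = B.mulVec v) : A = B := by
  refine Matrix.mulVec_injective (funext fun v => ?_)
  have hv : v ∈ ⨆ l, homogeneousComponent T l := by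
    rw [iSup_homogeneousComponent]
    trivial
  induction hv using Submodule.iSup_induction' with
  | mem l v hv => exact h l v hv
  | zero => simp
  | add x y _ _ hx hy => rw [Matrix.mulVec_add, Matrix.mulVec_add, hx, hy]

/-- The matrix that acts on each `V_λ` as the scalar `c λ`. -/
theorem sum_smul_primitiveIdempotent_mulVec {n : Type*} [Fintype n] [DecidableEq n]
    (T : Subalgebra ℂ (Matrix n n ℂ)) [IsSemisimpleModule T (n → ℂ)] (c : ModuleType T → ℂ)
    (l : ModuleType T) (v : n → ℂ) (hv : v ∈ homogeneousComponent T l) :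
    (∑ m, c m • primitiveIdempotent T m).mulVec v = c l • v := by
  rw [Matrix.sum_mulVec, Finset.sum_eq_single l]
  · rw [Matrix.smul_mulVec, primitiveIdempotent_mulVec_of_mem T l v hv]
  · intro m _ hm
    rw [Matrix.smul_mulVec, primitiveIdempotent_mulVec_of_ne T m l hm.symm v hv, smul_zero]
  · simp

/-- The algebra of functions on the set of types acts on `ℂ^n`, by scalars on each `V_λ`. -/
noncomputable def scalarHom {n : Type*} [Fintype n] [DecidableEq n]
    (T : Subalgebra ℂ (Matrix n n ℂ)) [IsSemisimpleModule T (n → ℂ)] :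
    (ModuleType T → ℂ) →ₐ[ℂ] Matrix n n ℂ :=
  AlgHom.ofLinearMap
    { toFun := fun c => ∑ m, c m • primitiveIdempotent T m
      map_add' := fun c c' => by simp [add_smul, Finset.sum_add_distrib]
      map_smul' := fun a c => by simp [mul_smul, Finset.smul_sum] }
    (ext_of_homogeneousComponent T _ _ fun l v hv => by
      rw [LinearMap.coe_mk, AddHom.coe_mk, sum_smul_primitiveIdempotent_mulVec T _ l v hv]
      simp)
    (fun c c' => ext_of_homogeneousComponent T _ _ fun l v hv => by
      simp only [LinearMap.coe_mk, AddHom.coe_mk]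
      rw [← Matrix.mulVec_mulVec, sum_smul_primitiveIdempotent_mulVec T _ l v hv,
        sum_smul_primitiveIdempotent_mulVec T _ l v hv, Matrix.mulVec_smul,
        sum_smul_primitiveIdempotent_mulVec T _ l v hv, smul_smul, Pi.mul_apply, mul_comm])

theorem scalarHom_apply {n : Type*} [Fintype n] [DecidableEq n]
    (T : Subalgebra ℂ (Matrix n n ℂ)) [IsSemisimpleModule T (n → ℂ)] (c : ModuleType T → ℂ) :
    scalarHom T c = ∑ m, c m • primitiveIdempotent T m := rfl

/-- Isotypic components are fully invariant, so the projection to one of them commutes with every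
`T`-endomorphism and the double centralizer property applies. -/
theorem primitiveIdempotent_mem {n : Type*} [Fintype n] [DecidableEq n]
    (T : Subalgebra ℂ (Matrix n n ℂ)) [IsSemisimpleModule T (n → ℂ)] (l : ModuleType T) :
    primitiveIdempotent T l ∈ T := by
  refine toMatrix'_mem_of_commute T _ fun g v => ?_
  have hfi : ∀ m, ∀ w ∈ homogeneousComponent T m, g w ∈ homogeneousComponent T m := fun m w hw =>
    Submodule.IsFullyInvariant.of_mem_isotypicComponents (homogeneousComponent_mem T m) g hw
  rw [← LinearMap.toMatrix'_mulVec, ← LinearMap.toMatrix'_mulVec]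
  change (primitiveIdempotent T l).mulVec (g v) = g ((primitiveIdempotent T l).mulVec v)
  have hv : v ∈ ⨆ l, homogeneousComponent T l := by
    rw [iSup_homogeneousComponent]
    trivial
  induction hv using Submodule.iSup_induction' with
  | mem m v hv =>
    by_cases hm : m = l
    · subst hm
      rw [primitiveIdempotent_mulVec_of_mem T m v hv,
        primitiveIdempotent_mulVec_of_mem T m _ (hfi m v hv)]
    · rw [primitiveIdempotent_mulVec_of_ne T l m hm v hv,
        primitiveIdempotent_mulVec_of_ne T l m hm _ (hfi m v hv), map_zero]
  | zero => simp
  | add x y _ _ hx hy => rw [map_add, Matrix.mulVec_add, Matrix.mulVec_add, map_add, hx, hy]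

theorem primitiveIdempotent_comm {n : Type*} [Fintype n] [DecidableEq n]
    (T : Subalgebra ℂ (Matrix n n ℂ)) [IsSemisimpleModule T (n → ℂ)] (l : ModuleType T)
    (A : Matrix n n ℂ) (hA : A ∈ T) :
    primitiveIdempotent T l * A = A * primitiveIdempotent T l := by
  refine ext_of_homogeneousComponent T _ _ fun m v hv => ?_
  have hAv : A.mulVec v ∈ homogeneousComponent T m :=
    (homogeneousComponent T m).smul_mem ⟨A, hA⟩ hv
  rw [← Matrix.mulVec_mulVec, ← Matrix.mulVec_mulVec]
  by_cases hm : m = l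
  · subst hm
    rw [primitiveIdempotent_mulVec_of_mem T m v hv, primitiveIdempotent_mulVec_of_mem T m _ hAv]
  · rw [primitiveIdempotent_mulVec_of_ne T l m hm v hv,
      primitiveIdempotent_mulVec_of_ne T l m hm _ hAv, Matrix.mulVec_zero]

/-- A linear endomorphism of an irreducible module that commutes with `T` is a scalar. -/
theorem exists_eq_smul_of_isSimpleModule {n : Type*} [Fintype n] [DecidableEq n]
    (T : Subalgebra ℂ (Matrix n n ℂ)) (W : Submodule T (n → ℂ)) [IsSimpleModule T W]
    (z : T) (hz : ∀ a : T, a * z = z * a) : ∃ c : ℂ, ∀ w ∈ W, z.1.mulVec w = c • w := by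
  have : FiniteDimensional ℂ W := inferInstanceAs (FiniteDimensional ℂ (W.restrictScalars ℂ))
  obtain ⟨c, hc⟩ := (IsSimpleModule.algebraMap_end_bijective_of_isAlgClosed (A := T) (V := W) ℂ).2
    { toFun := fun w => z • w
      map_add' := fun w w' => smul_add z w w'
      map_smul' := fun a w => by
        rw [RingHom.id_apply, smul_smul, smul_smul, hz a] }
  refine ⟨c, fun w hw => ?_⟩
  have := congrArg Subtype.val (LinearMap.congr_fun hc ⟨w, hw⟩)
  exact this.symm

/-- A central element acts as a scalar on each homogeneous component. -/
theorem exists_eq_smul_of_center {n : Type*} [Fintype n] [DecidableEq n]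
    (T : Subalgebra ℂ (Matrix n n ℂ)) (z : T) (hz : ∀ a : T, a * z = z * a) (l : ModuleType T) :
    ∃ c : ℂ, ∀ v ∈ homogeneousComponent T l, z.1.mulVec v = c • v := by
  induction l using Quotient.inductionOn with
  | h W =>
    have := W.2
    obtain ⟨c, hc⟩ := exists_eq_smul_of_isSimpleModule T W.1 z hz
    refine ⟨c, fun v hv => ?_⟩
    unfold homogeneousComponent at hv
    rw [sSup_eq_iSup'] at hv
    induction hv using Submodule.iSup_induction' with
    | mem U v hv =>
      obtain ⟨U, hU, hUW⟩ := U
      obtain ⟨e⟩ : Nonempty (U ≃ₗ[T] W.1) := Quotient.exact hUW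
      change v ∈ U at hv
      -- The element `z - c` of `T` kills `W`, hence kills every module isomorphic to `W`; so one
      -- scalar serves the whole type.
      have h1 := smul_eq_zero_of_equiv U W.1 e (z - algebraMap ℂ T c) ⟨v, hv⟩ (by
        change (z.1 - algebraMap ℂ _ c).mulVec _ = 0
        rw [Matrix.sub_mulVec, hc _ (e ⟨v, hv⟩).2, Algebra.algebraMap_eq_smul_one,
          Matrix.smul_mulVec, Matrix.one_mulVec, sub_self])
      change (z.1 - algebraMap ℂ _ c).mulVec v = 0 at h1
      rwa [Matrix.sub_mulVec, Algebra.algebraMap_eq_smul_one, Matrix.smul_mulVec,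
        Matrix.one_mulVec, sub_eq_zero] at h1
    | zero => simp
    | add x y _ _ hx hy => rw [Matrix.mulVec_add, hx, hy, smul_add]

/-- One inclusion holds because the `e_λ` lie in `T` and commute with it, the other by Schur's lemma
on each `V_λ`. -/
theorem range_scalarHom {n : Type*} [Fintype n] [DecidableEq n]
    (T : Subalgebra ℂ (Matrix n n ℂ)) [IsSemisimpleModule T (n → ℂ)] :
    (scalarHom T).range = (Subalgebra.center ℂ T).map T.val := by
  apply le_antisymm
  · rintro _ ⟨c, rfl⟩
    refine ⟨⟨∑ m, c m • primitiveIdempotent T m,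
      sum_mem fun m _ => T.smul_mem (primitiveIdempotent_mem T m) _⟩, ?_, rfl⟩
    refine Subalgebra.mem_center_iff.mpr fun a => Subtype.ext ?_
    change a.1 * (∑ m, c m • primitiveIdempotent T m) = (∑ m, c m • primitiveIdempotent T m) * a.1
    rw [Finset.mul_sum, Finset.sum_mul]
    refine Finset.sum_congr rfl fun m _ => ?_
    rw [Matrix.mul_smul, Matrix.smul_mul, primitiveIdempotent_comm T m a.1 a.2]
  · rintro _ ⟨z, hz, rfl⟩
    choose c hc using exists_eq_smul_of_center T z (Subalgebra.mem_center_iff.mp hz)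
    refine ⟨c, ext_of_homogeneousComponent T _ _ fun l v hv => ?_⟩
    exact (sum_smul_primitiveIdempotent_mulVec T c l v hv).trans (hc l v hv).symm

/-- The algebra of functions on a finite set is generated by two functions that jointly separate
the points. -/
theorem adjoin_pair_eq_top {ι : Type*} [Finite ι] (a b : ι → ℂ)
    (hab : ∀ i j, a i = a j → b i = b j → i = j) :
    Algebra.adjoin ℂ ({a, b} : Set (ι → ℂ)) = ⊤ := by
  classical
  have := Fintype.ofFinite ι
  have hind : ∀ f ∈ ({a, b} : Set (ι → ℂ)), ∀ i,
      (fun j => if f j = f i then 1 else 0) ∈ Algebra.adjoin ℂ ({a, b} : Set (ι → ℂ)) := by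
    intro f hf i
    -- A polynomial in `f` gives the indicator of a level set of `f`. A level set of `a` meets a
    -- level set of `b` in at most one point, so products of these indicators give all point
    -- indicators.
    let p : Polynomial ℂ := Lagrange.interpolate (Finset.univ.image f) id
      (fun c => if c = f i then 1 else 0)
    have hp : (fun j => if f j = f i then (1 : ℂ) else 0) = Polynomial.aeval f p := by
      ext j
      rw [Polynomial.aeval_pi_apply₂, Polynomial.coe_aeval_eq_eval]
      have h1 : p.eval (f j) = if f j = f i then 1 else 0 :=
        Lagrange.eval_interpolate_at_node (v := id) _ Function.injective_id.injOn
          (Finset.mem_image_of_mem f (Finset.mem_univ j))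
      exact h1.symm
    rw [hp]
    exact Algebra.adjoin_mono (Set.singleton_subset_iff.mpr hf)
      (Polynomial.aeval_mem_adjoin_singleton ℂ _)
  rw [eq_top_iff]
  intro c _
  have hc : c = ∑ i, c i • ((fun j => if a j = a i then (1 : ℂ) else 0) *
      (fun j => if b j = b i then (1 : ℂ) else 0)) := by
    ext j
    rw [Finset.sum_apply, Finset.sum_eq_single j]
    · simp
    · intro i _ hij
      by_cases h1 : a j = a i
      · have h2 : b j ≠ b i := fun h2 => hij (hab j i h1 h2).symm
        simp [h2]
      · simp [h1]
    · simp
  rw [hc]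
  exact sum_mem fun i _ => Subalgebra.smul_mem _
    (mul_mem (hind a (by simp) i) (hind b (by simp) i)) _

theorem adjoin_pair_eq_center {n : Type*} [Fintype n] [DecidableEq n]
    (T : Subalgebra ℂ (Matrix n n ℂ)) [IsSemisimpleModule T (n → ℂ)] (a b : ModuleType T → ℂ)
    (hab : ∀ l m, a l = a m → b l = b m → l = m) :
    Algebra.adjoin ℂ {∑ l, a l • primitiveIdempotent T l, ∑ l, b l • primitiveIdempotent T l} =
      (Subalgebra.center ℂ T).map T.val := by
  rw [← range_scalarHom, ← Algebra.map_top, ← adjoin_pair_eq_top a b hab, AlgHom.map_adjoin,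
    Set.image_pair, scalarHom_apply, scalarHom_apply]

theorem exists_smul_eq_of_isSimpleModule {A V : Type*} [Ring A] [AddCommGroup V] [Module A V]
    (W : Submodule A V) [IsSimpleModule A W] {v w : V} (hv : v ∈ W) (hw : w ∈ W) (hv0 : v ≠ 0) :
    ∃ a : A, a • v = w := by
  have hv0' : (⟨v, hv⟩ : W) ≠ 0 := fun h0 => hv0 (congrArg Subtype.val h0)
  obtain ⟨a, ha⟩ := IsSimpleModule.toSpanSingleton_surjective A hv0' ⟨w, hw⟩
  exact ⟨a, congrArg Subtype.val ha⟩

/-- Simple modules with nonzero vectors that have the same annihilator are isomorphic. -/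
theorem nonempty_linearEquiv_of_smul_eq_zero_iff {A V : Type*} [Ring A] [AddCommGroup V]
    [Module A V] (W W' : Submodule A V) [IsSimpleModule A W] [IsSimpleModule A W'] {v v' : V}
    (hv : v ∈ W) (hv' : v' ∈ W') (hv0 : v ≠ 0) (hv0' : v' ≠ 0)
    (hann : ∀ a : A, a • v = 0 ↔ a • v' = 0) : Nonempty (W ≃ₗ[A] W') := by
  have hs := IsSimpleModule.toSpanSingleton_surjective A (m := (⟨v, hv⟩ : W))
    fun h0 => hv0 (congrArg Subtype.val h0)
  have hs' := IsSimpleModule.toSpanSingleton_surjective A (m := (⟨v', hv'⟩ : W'))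
    fun h0 => hv0' (congrArg Subtype.val h0)
  have hker : LinearMap.ker (LinearMap.toSpanSingleton A W ⟨v, hv⟩) =
      LinearMap.ker (LinearMap.toSpanSingleton A W' ⟨v', hv'⟩) := by
    ext a
    simpa [Subtype.ext_iff] using hann a
  exact ⟨(LinearMap.quotKerEquivOfSurjective _ hs).symm ≪≫ₗ Submodule.quotEquivOfEq _ _ hker ≪≫ₗ
    LinearMap.quotKerEquivOfSurjective _ hs'⟩

end MatrixAlgebra

/-! ### Counting covers in the lattice of subspaces -/

theorem Submodule.covBy_iff_finrank {F H : Type*} [Field F] [AddCommGroup H] [Module F H]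
    [FiniteDimensional F H] {a b : Submodule F H} :
    a ⋖ b ↔ a ≤ b ∧ Module.finrank F b = Module.finrank F a + 1 := by
  constructor
  · intro hab
    refine ⟨hab.le, ?_⟩
    obtain ⟨v, hvb, hva⟩ := SetLike.exists_of_lt hab.lt
    have h1 : a < a ⊔ F ∙ v := by
      refine lt_of_le_of_ne le_sup_left fun h => hva ?_
      rw [h]
      exact Submodule.mem_sup_right (Submodule.mem_span_singleton_self v)
    have h2 : a ⊔ F ∙ v ≤ b :=
      sup_le hab.le ((Submodule.span_singleton_le_iff_mem v b).mpr hvb)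
    have h3 : a ⊔ F ∙ v = b := h2.eq_of_not_lt fun h => hab.2 h1 h
    have h4 := Submodule.finrank_add_le_finrank_add_finrank a (F ∙ v)
    have h5 := finrank_span_singleton (K := F) (v := v) (fun h => hva (h ▸ a.zero_mem))
    have h6 := Submodule.finrank_lt_finrank_of_lt hab.lt
    rw [h3] at h4
    omega
  · rintro ⟨hab, hd⟩
    refine ⟨lt_of_le_of_ne hab fun h => ?_, fun c hac hcb => ?_⟩
    · rw [h] at hd
      omega
    · have h1 := Submodule.finrank_lt_finrank_of_lt hac
      have h2 := Submodule.finrank_lt_finrank_of_lt hcb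
      omega

/-- The number of subspaces `z ≤ b` that cover `a` and meet `c` only in `a`. -/
theorem Submodule.ncard_covBy_disjoint {F H : Type*} [Field F] [Finite F] [AddCommGroup H]
    [Module F H] [FiniteDimensional F H] {a b c : Submodule F H} (hab : a ≤ b) (hac : a ≤ c)
    {m n : ℕ} (hm : Module.finrank F ↥(b ⊓ c) = Module.finrank F a + m)
    (hn : Module.finrank F b = Module.finrank F a + n) :
    {z | a ⋖ z ∧ z ≤ b ∧ z ⊓ c = a}.ncard * Nat.card F + Nat.card F ^ m =
      {z | a ⋖ z ∧ z ≤ b ∧ z ⊓ c = a}.ncard + Nat.card F ^ n := by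
  classical
  have : Finite H := Module.finite_of_finite F
  have := Fintype.ofFinite H
  have hcard : ∀ z : Submodule F H,
      (Finset.univ.filter (· ∈ z)).card = Nat.card F ^ Module.finrank F z := by
    intro z
    rw [← Module.natCard_eq_pow_finrank (K := F) (V := z), ← Fintype.card_subtype,
      Nat.card_eq_fintype_card]
  have hcard2 : ∀ z w : Submodule F H, w ≤ z →
      (Finset.univ.filter fun v => v ∈ z ∧ v ∉ w).card + Nat.card F ^ Module.finrank F w =
        Nat.card F ^ Module.finrank F z := by
    intro z w hwz
    rw [← hcard, ← hcard, ← Finset.card_union_of_disjoint]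
    · congr 1
      ext v
      simp only [Finset.mem_union, Finset.mem_filter, Finset.mem_univ, true_and]
      have := @hwz v
      tauto
    · rw [Finset.disjoint_filter]
      rintro v - ⟨_, hv⟩
      exact hv
  set S : Set (Submodule F H) := {z | a ⋖ z ∧ z ≤ b ∧ z ⊓ c = a} with hS
  have hSfin : S.Finite := Set.toFinite S
  -- The sets `z \ a` partition `b \ c`, the part of `v` being `a + ⟨v⟩`. Each part has `q^(dim a)
  -- (q - 1)` elements, so the number of `z` times `q - 1` is `q^n - q^m`; the statement is arranged
  -- to avoid subtraction in `ℕ`.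
  have hunion : (Finset.univ.filter fun v => v ∈ b ∧ v ∉ b ⊓ c) =
      hSfin.toFinset.biUnion fun z => Finset.univ.filter fun v => v ∈ z ∧ v ∉ a := by
    ext v
    simp only [Finset.mem_biUnion, Finset.mem_filter, Finset.mem_univ, true_and,
      Set.Finite.mem_toFinset, Submodule.mem_inf]
    constructor
    · rintro ⟨hvb, hvc⟩
      have hvc : v ∉ c := fun h => hvc ⟨hvb, h⟩
      have hva : v ∉ a := fun h => hvc (hac h)
      have hv0 : v ≠ 0 := fun h => hva (h ▸ a.zero_mem)
      have hdisj : c ⊓ F ∙ v = ⊥ := by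
        rw [inf_comm, ← disjoint_iff]
        exact (Submodule.disjoint_span_singleton' hv0).mpr hvc |>.symm
      have hmod : (a ⊔ F ∙ v) ⊓ c = a := by
        rw [sup_inf_assoc_of_le _ hac, inf_comm, hdisj, sup_bot_eq]
      have hmem : v ∈ a ⊔ F ∙ v :=
        Submodule.mem_sup_right (Submodule.mem_span_singleton_self v)
      refine ⟨a ⊔ F ∙ v, ⟨?_, ?_, hmod⟩, hmem, hva⟩
      · rw [Submodule.covBy_iff_finrank]
        refine ⟨le_sup_left, ?_⟩
        have h1 := Submodule.finrank_sup_add_finrank_inf_eq a (F ∙ v)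
        have h2 : a ⊓ F ∙ v = ⊥ := le_bot_iff.mp (hdisj ▸ inf_le_inf_right _ hac)
        rw [h2, finrank_bot, finrank_span_singleton hv0] at h1
        exact h1
      · exact sup_le hab ((Submodule.span_singleton_le_iff_mem v b).mpr hvb)
    · rintro ⟨z, ⟨_, hzb, hzc⟩, hvz, hva⟩
      refine ⟨hzb hvz, fun h => hva ?_⟩
      rw [← hzc]
      exact ⟨hvz, h.2⟩
  have hdisj : (hSfin.toFinset : Set (Submodule F H)).PairwiseDisjoint
      fun z => Finset.univ.filter fun v => v ∈ z ∧ v ∉ a := by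
    intro z hz z' hz' hne
    simp only [Set.Finite.coe_toFinset] at hz hz'
    refine Finset.disjoint_filter.mpr ?_
    rintro v - ⟨hvz, hva⟩ ⟨hvz', -⟩
    have h1 : a < z ⊓ z' := by
      refine lt_of_le_of_ne (le_inf hz.1.le hz'.1.le) fun h => hva ?_
      rw [h]
      exact ⟨hvz, hvz'⟩
    have h2 : z ⊓ z' = z := inf_le_left.eq_of_not_lt fun h => hz.1.2 h1 h
    have h3 : z ⊓ z' = z' := inf_le_right.eq_of_not_lt fun h => hz'.1.2 h1 h
    exact hne (h2.symm.trans h3)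
  have hsum := congrArg Finset.card hunion
  rw [Finset.card_biUnion hdisj] at hsum
  have hq : 0 < Nat.card F := Nat.card_pos
  have hterm : ∀ z ∈ hSfin.toFinset, (Finset.univ.filter fun v => v ∈ z ∧ v ∉ a).card =
      Nat.card F ^ Module.finrank F a * (Nat.card F - 1) := by
    intro z hz
    rw [Set.Finite.mem_toFinset] at hz
    have h1 := hcard2 z a hz.1.le
    rw [(Submodule.covBy_iff_finrank.mp hz.1).2, pow_succ] at h1
    rw [Nat.mul_sub, mul_one]
    omega
  rw [Finset.sum_congr rfl hterm, Finset.sum_const, smul_eq_mul,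
    ← Set.ncard_eq_toFinset_card S hSfin] at hsum
  have h2 := hcard2 b (b ⊓ c) inf_le_left
  rw [hsum, hm, hn, pow_add, pow_add] at h2
  have h3 : 0 < Nat.card F ^ Module.finrank F a := pow_pos hq _
  obtain ⟨p, hp⟩ : ∃ p, Nat.card F = p + 1 := ⟨Nat.card F - 1, by omega⟩
  have h4 : S.ncard * (Nat.card F - 1) + Nat.card F ^ m = Nat.card F ^ n := by
    apply Nat.eq_of_mul_eq_mul_left h3
    rw [← h2]
    ring
  rw [← h4]
  have h5 : S.ncard * Nat.card F = S.ncard * (Nat.card F - 1) + S.ncard := by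
    rw [hp]; simp; ring
  rw [h5]
  ring

/-- With `c = a` the disjointness condition is void, and the count is `(q² - 1)/(q - 1)`. -/
theorem Submodule.ncard_covBy_interval {F H : Type*} [Field F] [Finite F] [AddCommGroup H]
    [Module F H] [FiniteDimensional F H] {a b : Submodule F H} (hab : a ≤ b)
    (hn : Module.finrank F b = Module.finrank F a + 2) :
    {z | a ⋖ z ∧ z ⋖ b}.ncard = Nat.card F + 1 := by
  have h1 := Submodule.ncard_covBy_disjoint (c := a) (m := 0) hab le_rfl
    (by rw [inf_eq_right.mpr hab, add_zero]) hn
  have h2 : {z | a ⋖ z ∧ z ≤ b ∧ z ⊓ a = a} = {z | a ⋖ z ∧ z ⋖ b} := by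
    ext z
    simp only [Set.mem_ofPred_eq, Submodule.covBy_iff_finrank, inf_eq_right]
    constructor
    · rintro ⟨⟨h1, h2⟩, h3, h4⟩
      exact ⟨⟨h1, h2⟩, h3, by omega⟩
    · rintro ⟨⟨h1, h2⟩, h3, h4⟩
      exact ⟨⟨h1, h2⟩, h3, h1⟩
  rw [h2] at h1
  have hq : 1 < Nat.card F := Finite.one_lt_card
  set n := {z | a ⋖ z ∧ z ⋖ b}.ncard
  zify at h1 hq ⊢
  have : ((n : ℤ) - (Nat.card F + 1)) * (Nat.card F - 1) = 0 := by linear_combination h1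
  rcases mul_eq_zero.mp this with h | h <;> linarith

/-- The number of hyperplanes grows by the factor `q`, plus one, from a subspace to a cover. -/
theorem Submodule.ncard_covBy_succ {F H : Type*} [Field F] [Finite F] [AddCommGroup H]
    [Module F H] [FiniteDimensional F H] {x y : Submodule F H} (hxy : x ⋖ y) :
    {z | z ⋖ y}.ncard = Nat.card F * {w | w ⋖ x}.ncard + 1 := by
  classical
  have : Finite H := Module.finite_of_finite F
  have := Fintype.ofFinite (Submodule F H)
  have hmod : ∀ z, z ⋖ y → z ≠ x → x ⊓ z ⋖ x ∧ x ⊓ z ⋖ z := by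
    intro z hz hzx
    have h1 : x ⊔ z = y := by
      refine (sup_le hxy.le hz.le).eq_of_not_lt fun h => hxy.2 ?_ h
      refine lt_of_le_of_ne le_sup_left fun h' => hzx ?_
      have h2 : z ≤ x := h' ▸ le_sup_right
      exact h2.eq_of_not_lt fun h3 => hz.2 h3 hxy.lt
    have h2 := Submodule.finrank_sup_add_finrank_inf_eq x z
    rw [h1] at h2
    rw [Submodule.covBy_iff_finrank] at hz hxy
    rw [Submodule.covBy_iff_finrank, Submodule.covBy_iff_finrank]
    exact ⟨⟨inf_le_left, by omega⟩, inf_le_right, by omega⟩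
  rw [Set.ncard_eq_toFinset_card', Set.ncard_eq_toFinset_card', Set.toFinset_ofPred,
    Set.toFinset_ofPred, ← Finset.card_erase_add_one (a := x) (by simpa using hxy)]
  congr 1
  -- A hyperplane `z ≠ x` of `y` meets `x` in a hyperplane `w` of `x`. Of the `q + 1` subspaces
  -- strictly between `w` and `y`, all but `x` lie over `w`.
  rw [Finset.card_eq_sum_card_fiberwise (f := fun z => x ⊓ z)
    (t := Finset.univ.filter fun w => w ⋖ x)]
  · rw [Finset.sum_const_nat (m := Nat.card F), mul_comm]
    intro w hw
    rw [Finset.mem_filter] at hw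
    have hwx := hw.2
    have hd : Module.finrank F y = Module.finrank F w + 2 := by
      rw [(Submodule.covBy_iff_finrank.mp hxy).2, (Submodule.covBy_iff_finrank.mp hwx).2]
    have h1 := Submodule.ncard_covBy_interval (hwx.le.trans hxy.le) hd
    rw [Set.ncard_eq_toFinset_card', Set.toFinset_ofPred,
      ← Finset.card_erase_add_one (a := x) (by simpa using ⟨hwx, hxy⟩), add_left_inj] at h1
    rw [← h1]
    congr 1
    ext z
    simp only [Finset.mem_filter, Finset.mem_erase, Finset.mem_univ, true_and]
    constructor
    · rintro ⟨⟨hzx, hzy⟩, rfl⟩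
      exact ⟨hzx, (hmod z hzy hzx).2, hzy⟩
    · rintro ⟨hzx, hwz, hzy⟩
      refine ⟨⟨hzx, hzy⟩, ?_⟩
      have h2 := (hmod z hzy hzx).2
      exact ((le_inf hwx.le hwz.le).eq_of_not_lt fun h3 => hwz.2 h3 h2.lt).symm
  · intro z hz
    simp only [Finset.coe_erase, Finset.coe_filter, Finset.mem_univ, true_and,
      Set.mem_sdiff, Set.mem_ofPred_eq, Set.mem_singleton_iff] at hz ⊢
    exact (hmod z hz.1 hz.2).1

/-! ### Covers in the attenuated space and entries of words in `L` and `R` -/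

namespace AttenuatedSpace

theorem covBy_iff {F H : Type*} [Field F] [AddCommGroup H] [Module F H]
    {h : Submodule F H} {x y : AttenuatedSpace h} : x ⋖ y ↔ x.1 ⋖ y.1 := by
  constructor
  · rintro ⟨h1, h2⟩
    refine ⟨h1, fun c hc hcy => ?_⟩
    have hch : c ⊓ h = ⊥ := le_bot_iff.mp (y.2 ▸ inf_le_inf_right h hcy.le)
    exact @h2 ⟨c, hch⟩ hc hcy
  · rintro ⟨h1, h2⟩
    exact ⟨h1, fun c hc hcy => h2 hc hcy⟩

theorem covBy_iff_dim {F H : Type*} [Field F] [AddCommGroup H] [Module F H]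
    [FiniteDimensional F H] {h : Submodule F H} {x y : AttenuatedSpace h} :
    x ⋖ y ↔ x.1 ≤ y.1 ∧ dim y = dim x + 1 :=
  covBy_iff.trans Submodule.covBy_iff_finrank

theorem dim_add_finrank_le {F H : Type*} [Field F] [AddCommGroup H] [Module F H]
    [FiniteDimensional F H] {h : Submodule F H} (x : AttenuatedSpace h) :
    dim x + Module.finrank F h ≤ Module.finrank F H := by
  have h1 := Submodule.finrank_sup_add_finrank_inf_eq x.1 h
  rw [x.2, finrank_bot] at h1
  have h2 := Submodule.finrank_le (x.1 ⊔ h)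
  change Module.finrank F x.1 + _ ≤ _
  omega

theorem card_filter_eq_ncard {F H : Type*} [Field F] [Finite F] [AddCommGroup H] [Module F H]
    [FiniteDimensional F H] {h : Submodule F H} (p : Submodule F H → Prop)
    [DecidablePred fun z : AttenuatedSpace h => p z.1] :
    (Finset.univ.filter fun z : AttenuatedSpace h => p z.1).card =
      {z : Submodule F H | z ⊓ h = ⊥ ∧ p z}.ncard := by
  have hinj : Function.Injective (fun z : AttenuatedSpace h => z.1) := Subtype.val_injective
  rw [← Set.ncard_coe_finset, ← Set.ncard_image_of_injective _ hinj]
  congr 1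
  ext z
  constructor
  · rintro ⟨w, hw, rfl⟩
    exact ⟨w.2, by simpa using hw⟩
  · rintro ⟨h1, h2⟩
    exact ⟨⟨z, h1⟩, Finset.mem_coe.mpr (Finset.mem_filter.mpr ⟨Finset.mem_univ _, h2⟩), rfl⟩

/-- By the modular law, a cover `u` of `x` avoids `h` exactly when `u ⊓ (x ⊔ h) = x`, so the general
count applies with `b = ⊤` and `c = x ⊔ h`. -/
theorem ncard_upperCovers {F H : Type*} [Field F] [Finite F] [AddCommGroup H] [Module F H]
    [FiniteDimensional F H] {h : Submodule F H} {N M : ℕ} (hH : Module.finrank F H = N + M)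
    (hh : Module.finrank F h = M) (x : AttenuatedSpace h) :
    {u | u ⊓ h = ⊥ ∧ x.1 ⋖ u}.ncard * Nat.card F + Nat.card F ^ M =
      {u | u ⊓ h = ⊥ ∧ x.1 ⋖ u}.ncard + Nat.card F ^ (N + M - dim x) := by
  have hx := dim_add_finrank_le x
  have h1 := Submodule.finrank_sup_add_finrank_inf_eq x.1 h
  rw [x.2, finrank_bot] at h1
  have h2 : {u | u ⊓ h = ⊥ ∧ x.1 ⋖ u} = {z | x.1 ⋖ z ∧ z ≤ ⊤ ∧ z ⊓ (x.1 ⊔ h) = x.1} := by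
    ext u
    simp only [Set.mem_ofPred_eq, le_top, true_and]
    rw [and_comm]
    refine and_congr_right fun hu => ?_
    rw [inf_comm u (x.1 ⊔ h), sup_inf_assoc_of_le h hu.le, sup_eq_left, inf_comm h]
    constructor
    · intro h3
      rw [h3]
      exact bot_le
    · intro h3
      exact le_bot_iff.mp (x.2 ▸ le_inf h3 inf_le_right)
  rw [h2]
  refine Submodule.ncard_covBy_disjoint le_top le_sup_left ?_ ?_
  · rw [top_inf_eq]
    omega
  · rw [finrank_top]
    change _ = dim x + _
    omega

/-- The drop in the number of upper covers is an eigenvalue of `K`; this is the source of the `L K`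
term in the cubic relation. -/
theorem ncard_upperCovers_covBy {F H : Type*} [Field F] [Finite F] [AddCommGroup H] [Module F H]
    [FiniteDimensional F H] {h : Submodule F H} {N M : ℕ} (hH : Module.finrank F H = N + M)
    (hh : Module.finrank F h = M) {x y : AttenuatedSpace h} (hxy : x ⋖ y) :
    {u | u ⊓ h = ⊥ ∧ x.1 ⋖ u}.ncard =
      {u | u ⊓ h = ⊥ ∧ y.1 ⋖ u}.ncard + Nat.card F ^ (N + M - dim y) := by
  have h1 := ncard_upperCovers hH hh x
  have h2 := ncard_upperCovers hH hh y
  have h3 : N + M - dim x = N + M - dim y + 1 := by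
    have := dim_add_finrank_le y
    have := (covBy_iff_dim.mp hxy).2
    omega
  rw [h3, pow_succ] at h1
  have hq : 1 < Nat.card F := Finite.one_lt_card
  set a := {u | u ⊓ h = ⊥ ∧ x.1 ⋖ u}.ncard
  set b := {u | u ⊓ h = ⊥ ∧ y.1 ⋖ u}.ncard
  set p := Nat.card F ^ (N + M - dim y)
  zify at h1 h2 hq ⊢
  have : ((a : ℤ) - (b + p)) * (Nat.card F - 1) = 0 := by linear_combination h1 - h2
  rcases mul_eq_zero.mp this with h | h <;> linarith

/-- The number of common upper covers of two elements. -/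
noncomputable def commonCovers {F H : Type*} [Field F] [AddCommGroup H] [Module F H]
    {h : Submodule F H} (x z : AttenuatedSpace h) : ℕ :=
  {u | u ⊓ h = ⊥ ∧ x.1 ⋖ u ∧ z.1 ⋖ u}.ncard

open Classical in
-- A common cover of two distinct elements must be their join.
theorem commonCovers_of_ne {F H : Type*} [Field F] [AddCommGroup H] [Module F H]
    [FiniteDimensional F H] {h : Submodule F H} {x z : AttenuatedSpace h} (hxz : x ≠ z) :
    commonCovers x z =
      if (x.1 ⊔ z.1) ⊓ h = ⊥ ∧ x.1 ⋖ x.1 ⊔ z.1 ∧ z.1 ⋖ x.1 ⊔ z.1 then 1 else 0 := by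
  have key : ∀ u, x.1 ⋖ u → z.1 ⋖ u → u = x.1 ⊔ z.1 := by
    intro u hx hz
    refine ((sup_le hx.le hz.le).eq_of_not_lt fun hlt => hx.2 ?_ hlt).symm
    refine lt_of_le_of_ne le_sup_left fun he => hxz (Subtype.ext ?_)
    have h1 : z.1 ≤ x.1 := he ▸ le_sup_right
    exact (h1.eq_of_not_lt fun h2 => hz.2 h2 hx.lt).symm
  unfold commonCovers
  split_ifs with hc
  · rw [Set.ncard_eq_one]
    refine ⟨x.1 ⊔ z.1, Set.eq_singleton_iff_unique_mem.mpr ⟨hc, ?_⟩⟩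
    rintro u ⟨_, h1, h2⟩
    exact key u h1 h2
  · have : {u | u ⊓ h = ⊥ ∧ x.1 ⋖ u ∧ z.1 ⋖ u} = ∅ := by
      refine Set.eq_empty_iff_forall_notMem.mpr ?_
      rintro u ⟨h0, h1, h2⟩
      obtain rfl := key u h1 h2
      exact hc ⟨h0, h1, h2⟩
    rw [this, Set.ncard_empty]

open Classical in
-- Every subspace below `y` avoids `h` automatically, so an interval of length two is the same as in
-- the full subspace lattice.
theorem lowering_mul_lowering_apply {F H : Type*} [Field F] [Finite F] [AddCommGroup H]
    [Module F H] [FiniteDimensional F H] (h : Submodule F H) (w y : AttenuatedSpace h) :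
    (lowering h * lowering h) w y =
      if w.1 ≤ y.1 ∧ dim y = dim w + 2 then (Nat.card F : ℂ) + 1 else 0 := by
  have h1 : (lowering h * lowering h) w y =
      ((Finset.univ.filter fun z : AttenuatedSpace h => w.1 ⋖ z.1 ∧ z.1 ⋖ y.1).card : ℂ) := by
    rw [Matrix.mul_apply, Finset.card_filter, Nat.cast_sum]
    refine Finset.sum_congr rfl fun z _ => ?_
    simp only [lowering, Matrix.of_apply, covBy_iff]
    split_ifs <;> simp_all
  rw [h1, card_filter_eq_ncard (h := h) fun z => w.1 ⋖ z ∧ z ⋖ y.1]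
  split_ifs with hc
  · have h2 : {z | z ⊓ h = ⊥ ∧ w.1 ⋖ z ∧ z ⋖ y.1} = {z | w.1 ⋖ z ∧ z ⋖ y.1} := by
      ext z
      refine and_iff_right_of_imp fun hz => le_bot_iff.mp ?_
      rw [← y.2]
      exact inf_le_inf_right h hz.2.le
    rw [h2, Submodule.ncard_covBy_interval hc.1 hc.2]
    push_cast
    rfl
  · have h2 : {z | z ⊓ h = ⊥ ∧ w.1 ⋖ z ∧ z ⋖ y.1} = ∅ := by
      refine Set.eq_empty_iff_forall_notMem.mpr ?_
      rintro z ⟨_, h3, h4⟩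
      refine hc ⟨h3.le.trans h4.le, ?_⟩
      change Module.finrank F y.1 = Module.finrank F w.1 + 2
      rw [(Submodule.covBy_iff_finrank.mp h4).2, (Submodule.covBy_iff_finrank.mp h3).2]
    rw [h2, Set.ncard_empty, Nat.cast_zero]

theorem raising_mul_lowering_mul_lowering_apply {F H : Type*} [Field F] [Finite F]
    [AddCommGroup H] [Module F H] [FiniteDimensional F H] (h : Submodule F H)
    {x y : AttenuatedSpace h} (hxy : dim y = dim x + 1) :
    (raising h * (lowering h * lowering h)) x y =
      ((Nat.card F : ℂ) + 1) * ({w | w ⋖ x.1 ∧ w ≤ y.1}.ncard : ℂ) := by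
  classical
  have h1 : (raising h * (lowering h * lowering h)) x y = ((Nat.card F : ℂ) + 1) *
      ((Finset.univ.filter fun w : AttenuatedSpace h => w.1 ⋖ x.1 ∧ w.1 ≤ y.1).card : ℂ) := by
    rw [Matrix.mul_apply, Finset.card_filter, Nat.cast_sum, Finset.mul_sum]
    refine Finset.sum_congr rfl fun w _ => ?_
    rw [lowering_mul_lowering_apply]
    simp only [raising, Matrix.of_apply]
    by_cases hw : w ⋖ x
    · have h2 := (covBy_iff_dim.mp hw).2
      have h3 : dim y = dim w + 2 := by omega
      simp [hw, covBy_iff.mp hw, h3]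
    · simp [hw, covBy_iff.not.mp hw]
  rw [h1, card_filter_eq_ncard (h := h) fun w => w ⋖ x.1 ∧ w ≤ y.1]
  congr 3
  ext w
  refine and_iff_right_of_imp fun hw => le_bot_iff.mp ?_
  rw [← y.2]
  exact inf_le_inf_right h hw.2

theorem lowering_mul_lowering_mul_raising_apply {F H : Type*} [Field F] [Finite F]
    [AddCommGroup H] [Module F H] [FiniteDimensional F H] (h : Submodule F H)
    {x y : AttenuatedSpace h} (hxy : dim y = dim x + 1) :
    (lowering h * lowering h * raising h) x y =
      ((Nat.card F : ℂ) + 1) * ({u | u ⊓ h = ⊥ ∧ y.1 ⋖ u ∧ x.1 ≤ u}.ncard : ℂ) := by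
  classical
  rw [← card_filter_eq_ncard (h := h) fun u => y.1 ⋖ u ∧ x.1 ≤ u]
  rw [Matrix.mul_apply, Finset.card_filter, Nat.cast_sum, Finset.mul_sum]
  refine Finset.sum_congr rfl fun u _ => ?_
  rw [lowering_mul_lowering_apply]
  simp only [raising, Matrix.of_apply]
  by_cases hu : y ⋖ u
  · have h2 := (covBy_iff_dim.mp hu).2
    have h3 : dim u = dim x + 2 := by omega
    simp [hu, covBy_iff.mp hu, h3]
  · simp [hu, covBy_iff.not.mp hu]

theorem lowering_mul_raising_apply {F H : Type*} [Field F] [Finite F]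
    [AddCommGroup H] [Module F H] [FiniteDimensional F H] (h : Submodule F H)
    (x z : AttenuatedSpace h) :
    (lowering h * raising h) x z = (commonCovers x z : ℂ) := by
  classical
  rw [commonCovers, ← card_filter_eq_ncard (h := h) fun u => x.1 ⋖ u ∧ z.1 ⋖ u]
  rw [Matrix.mul_apply, Finset.card_filter, Nat.cast_sum]
  refine Finset.sum_congr rfl fun u _ => ?_
  simp only [lowering, raising, Matrix.of_apply, covBy_iff]
  split_ifs <;> simp_all

open Classical in
theorem lowering_mul_raising_mul_lowering_apply {F H : Type*} [Field F] [Finite F]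
    [AddCommGroup H] [Module F H] [FiniteDimensional F H] (h : Submodule F H)
    (x y : AttenuatedSpace h) :
    (lowering h * raising h * lowering h) x y =
      ((∑ z ∈ Finset.univ.filter fun z : AttenuatedSpace h => z.1 ⋖ y.1, commonCovers x z : ℕ) :
        ℂ) := by
  rw [Matrix.mul_apply, Nat.cast_sum, Finset.sum_filter]
  refine Finset.sum_congr rfl fun z _ => ?_
  rw [lowering_mul_raising_apply]
  simp only [lowering, Matrix.of_apply, covBy_iff]
  split_ifs <;> simp

end AttenuatedSpace

/-! ### The cubic relation -/

namespace AttenuatedSpace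

open Classical in
-- The term `z = x` counts all upper covers of `x`. Any other hyperplane `z` of `y` has join `y`
-- with `x`, hence contributes one, and there are `q` of these for each hyperplane of `x`.
theorem sum_commonCovers_of_covBy {F H : Type*} [Field F] [Finite F]
    [AddCommGroup H] [Module F H] [FiniteDimensional F H] {h : Submodule F H}
    {x y : AttenuatedSpace h} (hxy : x ⋖ y) :
    ∑ z ∈ Finset.univ.filter fun z : AttenuatedSpace h => z.1 ⋖ y.1, commonCovers x z =
      {u | u ⊓ h = ⊥ ∧ x.1 ⋖ u}.ncard + Nat.card F * {w | w ⋖ x.1}.ncard := by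
  have hx : x ∈ Finset.univ.filter fun z : AttenuatedSpace h => z.1 ⋖ y.1 :=
    Finset.mem_filter.mpr ⟨Finset.mem_univ _, covBy_iff.mp hxy⟩
  rw [← Finset.add_sum_erase _ _ hx]
  congr 1
  · unfold commonCovers
    simp only [and_self]
  · have h1 : ∀ z ∈ (Finset.univ.filter fun z : AttenuatedSpace h => z.1 ⋖ y.1).erase x,
        commonCovers x z = 1 := by
      intro z hz
      rw [Finset.mem_erase, Finset.mem_filter] at hz
      obtain ⟨hzx, -, hzy⟩ := hz
      have hxy' := covBy_iff.mp hxy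
      have h2 : x.1 ⊔ z.1 = y.1 := by
        refine (sup_le hxy'.le hzy.le).eq_of_not_lt fun hlt => hxy'.2 ?_ hlt
        refine lt_of_le_of_ne le_sup_left fun he => hzx (Subtype.ext ?_)
        have h3 : z.1 ≤ x.1 := he ▸ le_sup_right
        exact h3.eq_of_not_lt fun h4 => hzy.2 h4 hxy'.lt
      rw [commonCovers_of_ne hzx.symm, h2, if_pos ⟨y.2, hxy', hzy⟩]
    rw [Finset.sum_congr rfl h1, Finset.sum_const, smul_eq_mul, mul_one,
      Finset.card_erase_of_mem hx, card_filter_eq_ncard (h := h) fun z => z ⋖ y.1]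
    have h5 : {z | z ⊓ h = ⊥ ∧ z ⋖ y.1} = {z | z ⋖ y.1} := by
      ext z
      refine and_iff_right_of_imp fun hz => le_bot_iff.mp ?_
      rw [← y.2]
      exact inf_le_inf_right h hz.le
    rw [h5, Submodule.ncard_covBy_succ (covBy_iff.mp hxy), Nat.add_sub_cancel]

/-- For `x ≰ y` with `x ⊓ y` of codimension one in `x`, the `z` covered by `y` that have a common
cover with `x` are the `z` between `x ⊓ y` and `y` that avoid `x ⊔ h`. -/
theorem sup_covBy_iff {F H : Type*} [Field F] [AddCommGroup H] [Module F H]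
    [FiniteDimensional F H] {h : Submodule F H} {x y z : Submodule F H} (hx : x ⊓ h = ⊥)
    (hd : Module.finrank F y = Module.finrank F x + 1) (hxy : x ⊓ y ⋖ x) :
    (z ⋖ y ∧ (x ⊔ z) ⊓ h = ⊥ ∧ x ⋖ x ⊔ z ∧ z ⋖ x ⊔ z) ↔
      x ⊓ y ⋖ z ∧ z ≤ y ∧ z ⊓ (x ⊔ h) = x ⊓ y := by
  -- Expanding `(x ⊔ z) ⊓ (x ⊔ h)` by the modular law in two ways turns the condition that `x ⊔ z`
  -- avoids `h` into one on `z ⊓ (x ⊔ h)`.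
  have hmod : (x ⊔ z) ⊓ (x ⊔ h) = x ⊔ z ⊓ (x ⊔ h) := sup_inf_assoc_of_le z le_sup_left
  have hmod' : (x ⊔ h) ⊓ (x ⊔ z) = x ⊔ h ⊓ (x ⊔ z) := sup_inf_assoc_of_le h le_sup_left
  have hfr := Submodule.finrank_sup_add_finrank_inf_eq x z
  have hdw := (Submodule.covBy_iff_finrank.mp hxy).2
  constructor
  · rintro ⟨hzy, hbot, hxs, hzs⟩
    have h1 : x ⊓ z ≤ x ⊓ y := inf_le_inf_left x hzy.le
    have h2 := (Submodule.covBy_iff_finrank.mp hxs).2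
    have h3 := (Submodule.covBy_iff_finrank.mp hzs).2
    have h4 : x ⊓ z = x ⊓ y := Submodule.eq_of_le_of_finrank_eq h1 (by omega)
    have h5 : x ⊓ y ≤ z := h4 ▸ inf_le_right
    refine ⟨?_, hzy.le, le_antisymm (le_inf ?_ (inf_le_left.trans hzy.le))
      (le_inf h5 (inf_le_left.trans le_sup_left))⟩
    · rw [Submodule.covBy_iff_finrank]
      exact ⟨h5, by omega⟩
    · rw [inf_comm (x ⊔ h), inf_comm h, hbot, sup_bot_eq, hmod] at hmod'
      exact sup_eq_left.mp hmod'
  · rintro ⟨hwz, hzy, hz⟩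
    have h1 : x ⊓ z = x ⊓ y :=
      le_antisymm (inf_le_inf_left x hzy) (le_inf inf_le_left hwz.le)
    have h2 := (Submodule.covBy_iff_finrank.mp hwz).2
    rw [h1] at hfr
    refine ⟨?_, ?_, ?_, ?_⟩
    · rw [Submodule.covBy_iff_finrank]
      exact ⟨hzy, by omega⟩
    · rw [hz, (sup_eq_left.mpr inf_le_left : x ⊔ x ⊓ y = x)] at hmod
      rw [← le_bot_iff, ← hx]
      have h3 : (x ⊔ z) ⊓ h ≤ (x ⊔ z) ⊓ (x ⊔ h) := inf_le_inf_left _ le_sup_right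
      exact le_inf (h3.trans hmod.le) inf_le_right
    · rw [Submodule.covBy_iff_finrank]
      exact ⟨le_sup_left, by omega⟩
    · rw [Submodule.covBy_iff_finrank]
      exact ⟨le_sup_right, by omega⟩

open Classical in
theorem sum_commonCovers_of_not_le {F H : Type*} [Field F] [Finite F]
    [AddCommGroup H] [Module F H] [FiniteDimensional F H] {h : Submodule F H}
    {x y : AttenuatedSpace h} (hxy : ¬ x.1 ≤ y.1) :
    ∑ z ∈ Finset.univ.filter fun z : AttenuatedSpace h => z.1 ⋖ y.1, commonCovers x z =
      {z | z ⋖ y.1 ∧ (x.1 ⊔ z) ⊓ h = ⊥ ∧ x.1 ⋖ x.1 ⊔ z ∧ z ⋖ x.1 ⊔ z}.ncard := by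
  have h1 : ∀ z ∈ Finset.univ.filter fun z : AttenuatedSpace h => z.1 ⋖ y.1,
      commonCovers x z =
        if (x.1 ⊔ z.1) ⊓ h = ⊥ ∧ x.1 ⋖ x.1 ⊔ z.1 ∧ z.1 ⋖ x.1 ⊔ z.1 then 1 else 0 := by
    intro z hz
    refine commonCovers_of_ne fun he => hxy ?_
    rw [he]
    exact (Finset.mem_filter.mp hz).2.le
  rw [Finset.sum_congr rfl h1, ← Finset.card_filter, Finset.filter_filter,
    card_filter_eq_ncard (h := h) fun z =>
      z ⋖ y.1 ∧ (x.1 ⊔ z) ⊓ h = ⊥ ∧ x.1 ⋖ x.1 ⊔ z ∧ z ⋖ x.1 ⊔ z]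
  congr 1
  ext z
  refine and_iff_right_of_imp fun hz => le_bot_iff.mp ?_
  rw [← y.2]
  exact inf_le_inf_right h hz.1.le

/-- The covers of `y` that contain `x`, for `x ≰ y`: only `x ⊔ y` is possible. -/
theorem covBy_and_le_iff_eq_sup {F H : Type*} [Field F] [AddCommGroup H] [Module F H]
    [FiniteDimensional F H] {x y u : Submodule F H} (hxy : ¬ x ≤ y) :
    y ⋖ u ∧ x ≤ u ↔ u = x ⊔ y ∧ x ⊓ y ⋖ x := by
  have hfr := Submodule.finrank_sup_add_finrank_inf_eq x y
  constructor
  · rintro ⟨hyu, hxu⟩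
    have h1 : u = x ⊔ y := by
      refine ((sup_le hxu hyu.le).eq_of_not_lt fun hlt => hyu.2 ?_ hlt).symm
      exact lt_of_le_of_ne le_sup_right fun he => hxy (he ▸ le_sup_left)
    subst h1
    refine ⟨rfl, Submodule.covBy_iff_finrank.mpr ⟨inf_le_left, ?_⟩⟩
    have := (Submodule.covBy_iff_finrank.mp hyu).2
    omega
  · rintro ⟨rfl, hc⟩
    refine ⟨Submodule.covBy_iff_finrank.mpr ⟨le_sup_right, ?_⟩, le_sup_left⟩
    have := (Submodule.covBy_iff_finrank.mp hc).2
    omega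

theorem covBy_and_le_iff_eq_inf {F H : Type*} [Field F] [AddCommGroup H] [Module F H]
    [FiniteDimensional F H] {x y w : Submodule F H} (hxy : ¬ x ≤ y) :
    w ⋖ x ∧ w ≤ y ↔ w = x ⊓ y ∧ x ⊓ y ⋖ x := by
  constructor
  · rintro ⟨hwx, hwy⟩
    have h1 : w = x ⊓ y := by
      refine (le_inf hwx.le hwy).eq_of_not_lt fun hlt => hwx.2 hlt ?_
      exact lt_of_le_of_ne inf_le_left fun he => hxy (he ▸ inf_le_right)
    subst h1
    exact ⟨rfl, hwx⟩
  · rintro ⟨rfl, hc⟩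
    exact ⟨hc, inf_le_right⟩

/-- Both sides vanish unless `w = x ⊓ y` is a hyperplane of `x`. In that case `z` runs over the `q +
1` subspaces strictly between `w` and `y`, except those meeting `x ⊔ h` outside `w`. None is
excluded if `x ⊔ y` avoids `h`; otherwise exactly one is. So the left side is `q + 1` or `q`,
according to whether `x ⊔ y` belongs to the poset. -/
theorem ncard_eq_of_not_le {F H : Type*} [Field F] [Finite F] [AddCommGroup H] [Module F H]
    [FiniteDimensional F H] {h : Submodule F H} {x y : AttenuatedSpace h} (hxy : ¬ x.1 ≤ y.1)
    (hd : dim y = dim x + 1) :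
    {z | z ⋖ y.1 ∧ (x.1 ⊔ z) ⊓ h = ⊥ ∧ x.1 ⋖ x.1 ⊔ z ∧ z ⋖ x.1 ⊔ z}.ncard =
      Nat.card F * {w | w ⋖ x.1 ∧ w ≤ y.1}.ncard +
        {u | u ⊓ h = ⊥ ∧ y.1 ⋖ u ∧ x.1 ≤ u}.ncard := by
  simp only [covBy_and_le_iff_eq_sup hxy, covBy_and_le_iff_eq_inf hxy]
  have hq : 1 < Nat.card F := Finite.one_lt_card
  by_cases hw : x.1 ⊓ y.1 ⋖ x.1
  · simp only [sup_covBy_iff x.2 hd hw, hw, and_true]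
    have hdw : Module.finrank F x.1 = Module.finrank F ↥(x.1 ⊓ y.1) + 1 :=
      (Submodule.covBy_iff_finrank.mp hw).2
    have hdy : Module.finrank F y.1 = Module.finrank F x.1 + 1 := hd
    have h1 : {w | w = x.1 ⊓ y.1}.ncard = 1 := Set.ncard_singleton _
    rw [h1, mul_one]
    have hsup := Submodule.finrank_sup_add_finrank_inf_eq x.1 y.1
    have hcount := fun m hm => Submodule.ncard_covBy_disjoint (a := x.1 ⊓ y.1) (b := y.1)
      (c := x.1 ⊔ h) inf_le_right (inf_le_left.trans le_sup_left) (m := m) (n := 2) hm (by omega)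
    -- Computing the dimension of `(x ⊔ y) ⊓ (x ⊔ h)` in two ways shows that `y ⊓ (x ⊔ h)` exceeds
    -- `x ⊓ y` by the dimension of `h ⊓ (x ⊔ y)`.
    have hmod : (x.1 ⊔ h) ⊓ (x.1 ⊔ y.1) = x.1 ⊔ h ⊓ (x.1 ⊔ y.1) :=
      sup_inf_assoc_of_le h le_sup_left
    have hmod2 : (x.1 ⊔ y.1) ⊓ (x.1 ⊔ h) = x.1 ⊔ y.1 ⊓ (x.1 ⊔ h) :=
      sup_inf_assoc_of_le y.1 le_sup_left
    have hinf := Submodule.finrank_sup_add_finrank_inf_eq x.1 (y.1 ⊓ (x.1 ⊔ h))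
    have hinf2 : x.1 ⊓ (y.1 ⊓ (x.1 ⊔ h)) = x.1 ⊓ y.1 := by
      rw [← inf_assoc]
      exact inf_eq_left.mpr (inf_le_left.trans le_sup_left)
    rw [hinf2, ← hmod2, inf_comm (x.1 ⊔ y.1), hmod] at hinf
    have hdisj := Submodule.finrank_sup_add_finrank_inf_eq x.1 (h ⊓ (x.1 ⊔ y.1))
    have hx0 : x.1 ⊓ (h ⊓ (x.1 ⊔ y.1)) = ⊥ := by
      rw [← inf_assoc, x.2, bot_inf_eq]
    rw [hx0, finrank_bot] at hdisj
    by_cases hb : (x.1 ⊔ y.1) ⊓ h = ⊥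
    · have h2 : {u | u ⊓ h = ⊥ ∧ u = x.1 ⊔ y.1} = {x.1 ⊔ y.1} := by
        ext u
        simp only [Set.mem_ofPred_eq, Set.mem_singleton_iff]
        refine and_iff_right_of_imp ?_
        rintro rfl
        exact hb
      rw [h2, Set.ncard_singleton]
      rw [inf_comm h, hb, finrank_bot] at hdisj
      rw [inf_comm h, hb] at hinf
      have h3 := hcount 0 (by omega)
      set n := {z | x.1 ⊓ y.1 ⋖ z ∧ z ≤ y.1 ∧ z ⊓ (x.1 ⊔ h) = x.1 ⊓ y.1}.ncard
      zify at h3 hq ⊢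
      have : ((n : ℤ) - (Nat.card F + 1)) * (Nat.card F - 1) = 0 := by linear_combination h3
      rcases mul_eq_zero.mp this with h | h <;> linarith
    · have h2 : {u | u ⊓ h = ⊥ ∧ u = x.1 ⊔ y.1} = ∅ := by
        refine Set.eq_empty_iff_forall_notMem.mpr ?_
        rintro u ⟨h0, rfl⟩
        exact hb h0
      rw [h2, Set.ncard_empty]
      have h4 : 0 < Module.finrank F ↥(h ⊓ (x.1 ⊔ y.1)) := by
        rw [inf_comm]
        exact Nat.pos_of_ne_zero fun h0 => hb (Submodule.finrank_eq_zero.mp h0)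
      -- As `y` avoids `h` and has codimension one in `x ⊔ y`, the space `h ⊓ (x ⊔ y)` has dimension
      -- at most one.
      have h5 := Submodule.finrank_sup_add_finrank_inf_eq y.1 (h ⊓ (x.1 ⊔ y.1))
      have hy0 : y.1 ⊓ (h ⊓ (x.1 ⊔ y.1)) = ⊥ := by
        rw [← inf_assoc, y.2, bot_inf_eq]
      have h6 := Submodule.finrank_mono (sup_le le_sup_right inf_le_right :
        y.1 ⊔ h ⊓ (x.1 ⊔ y.1) ≤ x.1 ⊔ y.1)
      rw [hy0, finrank_bot] at h5
      have h3 := hcount 1 (by omega)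
      set n := {z | x.1 ⊓ y.1 ⋖ z ∧ z ≤ y.1 ∧ z ⊓ (x.1 ⊔ h) = x.1 ⊓ y.1}.ncard
      zify at h3 hq ⊢
      have : ((n : ℤ) - Nat.card F) * (Nat.card F - 1) = 0 := by linear_combination h3
      rcases mul_eq_zero.mp this with h | h <;> linarith
  · have h1 : {z | z ⋖ y.1 ∧ (x.1 ⊔ z) ⊓ h = ⊥ ∧ x.1 ⋖ x.1 ⊔ z ∧ z ⋖ x.1 ⊔ z} = ∅ := by
      refine Set.eq_empty_iff_forall_notMem.mpr ?_
      rintro z ⟨hzy, _, -, hzs⟩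
      have hxz : x.1 ⊓ z ⋖ x.1 := by
        have h2 := Submodule.finrank_sup_add_finrank_inf_eq x.1 z
        have h3 := (Submodule.covBy_iff_finrank.mp hzs).2
        exact Submodule.covBy_iff_finrank.mpr ⟨inf_le_left, by omega⟩
      refine hw ⟨lt_of_le_of_ne inf_le_left fun he => hxy (he ▸ inf_le_right), fun c hc hcx => ?_⟩
      exact hxz.2 (lt_of_le_of_lt (inf_le_inf_left _ hzy.le) hc) hcx
    rw [h1]
    simp [hw]

/-- The cubic relation between `L`, `R` and `K` in the incidence algebra. -/
theorem lowering_raising_relation {F H : Type*} [Field F] [Finite F] [AddCommGroup H] [Module F H]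
    [FiniteDimensional F H] {h : Submodule F H} {N M : ℕ} (hH : Module.finrank F H = N + M)
    (hh : Module.finrank F h = M) :
    (Nat.card F : ℂ) • (raising h * (lowering h * lowering h)) +
      lowering h * lowering h * raising h + ((Nat.card F : ℂ) + 1) • (lowering h * matK h N M) =
    ((Nat.card F : ℂ) + 1) • (lowering h * raising h * lowering h) := by
  classical
  ext x y
  simp only [Matrix.add_apply, Matrix.smul_apply, smul_eq_mul]
  have hK : (lowering h * matK h N M) x y =
      if x ⋖ y then ((Nat.card F ^ (N + M - dim y) : ℕ) : ℂ) else 0 := by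
    have hy := dim_add_finrank_le y
    have hyN : dim y ≤ N := by omega
    rw [matK_eq_diagonal, Matrix.mul_diagonal, if_pos hyN]
    simp only [lowering, Matrix.of_apply]
    have h1 : (N : ℤ) + M - dim y = ((N + M - dim y : ℕ) : ℤ) := by omega
    rw [h1, zpow_natCast]
    split_ifs <;> simp
  rw [hK]
  -- Each word lowers the dimension by one, so all other entries vanish. In the remaining entries
  -- the inequality `x ≤ y` decides whether the `K` term occurs.
  by_cases hd : dim y = dim x + 1
  · rw [raising_mul_lowering_mul_lowering_apply h hd, lowering_mul_lowering_mul_raising_apply h hd,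
      lowering_mul_raising_mul_lowering_apply]
    by_cases hxy : x.1 ≤ y.1
    · have hc : x ⋖ y := covBy_iff_dim.mpr ⟨hxy, hd⟩
      rw [sum_commonCovers_of_covBy hc, if_pos hc, ncard_upperCovers_covBy hH hh hc]
      have h1 : {w | w ⋖ x.1 ∧ w ≤ y.1} = {w | w ⋖ x.1} := by
        ext w
        exact and_iff_left_of_imp fun hw => hw.le.trans hxy
      have h2 : {u | u ⊓ h = ⊥ ∧ y.1 ⋖ u ∧ x.1 ≤ u} = {u | u ⊓ h = ⊥ ∧ y.1 ⋖ u} := by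
        ext u
        exact and_congr_right fun _ => and_iff_left_of_imp fun hu => hxy.trans hu.le
      rw [h1, h2]
      push_cast
      ring
    · have hc : ¬ x ⋖ y := fun hc => hxy hc.le
      rw [sum_commonCovers_of_not_le hxy, if_neg hc, ncard_eq_of_not_le hxy hd]
      push_cast
      ring
  · have hc : ¬ x ⋖ y := fun hc => hd (covBy_iff_dim.mp hc).2
    have h1 : (raising h * (lowering h * lowering h)) x y = 0 := by
      rw [Matrix.mul_apply]
      refine Finset.sum_eq_zero fun w _ => ?_
      rw [lowering_mul_lowering_apply]
      simp only [raising, Matrix.of_apply]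
      by_cases hw : w ⋖ x
      · have := (covBy_iff_dim.mp hw).2
        rw [if_neg (c := _ ∧ _) (by omega), mul_zero]
      · rw [if_neg hw, zero_mul]
    have h2 : (lowering h * lowering h * raising h) x y = 0 := by
      rw [Matrix.mul_apply]
      refine Finset.sum_eq_zero fun u _ => ?_
      rw [lowering_mul_lowering_apply]
      simp only [raising, Matrix.of_apply]
      by_cases hu : y ⋖ u
      · have := (covBy_iff_dim.mp hu).2
        rw [if_neg (c := _ ∧ _) (by omega), zero_mul]
      · rw [if_neg hu, mul_zero]
    have h3 : (lowering h * raising h * lowering h) x y = 0 := by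
      rw [mul_assoc, Matrix.mul_apply]
      refine Finset.sum_eq_zero fun u _ => ?_
      by_cases hu : x ⋖ u
      · rw [Matrix.mul_apply, Finset.sum_eq_zero, mul_zero]
        intro z _
        simp only [raising, lowering, Matrix.of_apply]
        by_cases hz : z ⋖ u
        · have h4 := (covBy_iff_dim.mp hz).2
          have h5 := (covBy_iff_dim.mp hu).2
          have h6 : ¬ z ⋖ y := fun hzy => by
            have := (covBy_iff_dim.mp hzy).2
            omega
          rw [if_neg h6, mul_zero]
        · rw [if_neg hz, zero_mul]
      · simp only [lowering, Matrix.of_apply]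
        rw [if_neg hu, zero_mul]
    rw [h1, h2, h3, if_neg hc]
    simp

end AttenuatedSpace

open Matrix in
-- The transpose of the cubic relation, solved for `L R R`, so that `L` can be moved past powers of
-- `R`.
theorem AttenuatedSpace.raising_lowering_relation {F H : Type*} [Field F] [Finite F]
    [AddCommGroup H] [Module F H] [FiniteDimensional F H] {h : Submodule F H} {N M : ℕ}
    (hH : Module.finrank F H = N + M) (hh : Module.finrank F h = M)
    (v : AttenuatedSpace h → ℂ) :
    lowering h *ᵥ (raising h *ᵥ (raising h *ᵥ v)) =
      ((Nat.card F : ℂ) + 1) • (raising h *ᵥ (lowering h *ᵥ (raising h *ᵥ v))) -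
      (Nat.card F : ℂ) • (raising h *ᵥ (raising h *ᵥ (lowering h *ᵥ v))) -
      ((Nat.card F : ℂ) + 1) • (matK h N M *ᵥ (raising h *ᵥ v)) := by
  have hR : (raising h)ᵀ = lowering h := rfl
  have hL : (lowering h)ᵀ = raising h := rfl
  have hK : (matK h N M)ᵀ = matK h N M := by
    rw [matK_eq_diagonal, Matrix.diagonal_transpose]
  have h1 := congrArg (fun A => Aᵀ *ᵥ v) (lowering_raising_relation hH hh)
  simp only [Matrix.transpose_add, Matrix.transpose_smul, Matrix.transpose_mul, hR, hL, hK,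
    Matrix.add_mulVec, Matrix.smul_mulVec, ← Matrix.mulVec_mulVec] at h1
  rw [← h1]
  abel

/-! ### The grading by dimension -/

namespace AttenuatedSpace

open Matrix

/-- The vectors supported on the elements of dimension `i`. -/
def grade {F H : Type*} [Field F] [AddCommGroup H] [Module F H] (h : Submodule F H) (i : ℕ) :
    Submodule ℂ (AttenuatedSpace h → ℂ) where
  carrier := {v | ∀ y, dim y ≠ i → v y = 0}
  add_mem' := fun {a b} ha hb y hy => by rw [Pi.add_apply, ha y hy, hb y hy, add_zero]
  zero_mem' := fun _ _ => rfl
  smul_mem' := fun c v hv y hy => by rw [Pi.smul_apply, hv y hy, smul_zero]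

theorem eq_zero_of_mem_grade {F H : Type*} [Field F] [AddCommGroup H] [Module F H]
    [FiniteDimensional F H] {h : Submodule F H} {N M : ℕ} (hH : Module.finrank F H = N + M)
    (hh : Module.finrank F h = M) {i : ℕ} (hi : N < i) {v : AttenuatedSpace h → ℂ}
    (hv : v ∈ grade h i) : v = 0 := by
  ext y
  have := dim_add_finrank_le y
  exact hv y (by omega)

section

variable {F H : Type*} [Field F] [Finite F] [AddCommGroup H] [Module F H]
    [FiniteDimensional F H] {h : Submodule F H}

theorem proj_mulVec_apply (i : ℕ) (v : AttenuatedSpace h → ℂ) (y : AttenuatedSpace h) :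
    (proj h i *ᵥ v) y = if dim y = i then v y else 0 := by
  rw [proj, Matrix.mulVec_diagonal]
  split_ifs <;> simp

theorem proj_mulVec_mem_grade (i : ℕ) (v : AttenuatedSpace h → ℂ) : proj h i *ᵥ v ∈ grade h i :=
  fun y hy => by rw [proj_mulVec_apply, if_neg hy]

theorem proj_mulVec_of_mem_grade {i : ℕ} {v : AttenuatedSpace h → ℂ} (hv : v ∈ grade h i) :
    proj h i *ᵥ v = v := by
  ext y
  rw [proj_mulVec_apply]
  split_ifs with hy
  · rfl
  · exact (hv y hy).symm

theorem raising_mulVec_mem_grade {i : ℕ} {v : AttenuatedSpace h → ℂ} (hv : v ∈ grade h i) :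
    raising h *ᵥ v ∈ grade h (i + 1) := by
  intro x hx
  refine Finset.sum_eq_zero fun y _ => ?_
  by_cases hy : dim y = i
  · have : ¬ y ⋖ x := fun hyx => hx (by rw [(covBy_iff_dim.mp hyx).2, hy])
    simp [raising, this]
  · rw [hv y hy, mul_zero]

theorem lowering_mulVec_mem_grade {i : ℕ} {v : AttenuatedSpace h → ℂ} (hv : v ∈ grade h (i + 1)) :
    lowering h *ᵥ v ∈ grade h i := by
  intro x hx
  refine Finset.sum_eq_zero fun y _ => ?_
  by_cases hy : dim y = i + 1
  · have : ¬ x ⋖ y := fun hxy => hx (by have := (covBy_iff_dim.mp hxy).2; omega)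
    simp [lowering, this]
  · rw [hv y hy, mul_zero]

theorem lowering_mulVec_of_mem_grade_zero {v : AttenuatedSpace h → ℂ} (hv : v ∈ grade h 0) :
    lowering h *ᵥ v = 0 := by
  ext x
  refine Finset.sum_eq_zero fun y _ => ?_
  by_cases hy : dim y = 0
  · have : ¬ x ⋖ y := fun hxy => by have := (covBy_iff_dim.mp hxy).2; omega
    simp [lowering, this]
  · rw [hv y hy, mul_zero]

theorem raising_pow_mulVec_succ (v : AttenuatedSpace h → ℂ) (i : ℕ) :
    raising h ^ (i + 1) *ᵥ v = raising h *ᵥ (raising h ^ i *ᵥ v) := by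
  rw [pow_succ', Matrix.mulVec_mulVec]

theorem raising_pow_mulVec_mem_grade {r : ℕ} {v : AttenuatedSpace h → ℂ} (hv : v ∈ grade h r)
    (i : ℕ) : raising h ^ i *ᵥ v ∈ grade h (r + i) := by
  induction i with
  | zero => simpa using hv
  | succ i ih =>
    rw [raising_pow_mulVec_succ]
    exact raising_mulVec_mem_grade ih

theorem matK_mulVec_of_mem_grade {N M : ℕ} (hH : Module.finrank F H = N + M)
    (hh : Module.finrank F h = M) {i : ℕ} {v : AttenuatedSpace h → ℂ} (hv : v ∈ grade h i) :
    matK h N M *ᵥ v = (Nat.card F : ℂ) ^ ((N : ℤ) + M - i) • v := by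
  ext y
  rw [matK_eq_diagonal, Matrix.mulVec_diagonal, Pi.smul_apply, smul_eq_mul]
  have := dim_add_finrank_le y
  rw [if_pos (by omega)]
  by_cases hy : dim y = i
  · rw [hy]
  · rw [hv y hy, mul_zero, mul_zero]

theorem matK_inv_mulVec_of_mem_grade {N M : ℕ} (hH : Module.finrank F H = N + M)
    (hh : Module.finrank F h = M) {i : ℕ} {v : AttenuatedSpace h → ℂ} (hv : v ∈ grade h i) :
    (matK h N M)⁻¹ *ᵥ v = ((Nat.card F : ℂ) ^ ((N : ℤ) + M - i))⁻¹ • v := by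
  have hq : (Nat.card F : ℂ) ≠ 0 := by exact_mod_cast Nat.card_pos.ne'
  -- Matrix inversion is meaningful only for a unit determinant; no element has dimension above `N`,
  -- so no diagonal entry of `K` is zero.
  have hu : IsUnit (matK h N M).det := by
    rw [matK_eq_diagonal, Matrix.det_diagonal, isUnit_iff_ne_zero]
    refine Finset.prod_ne_zero_iff.mpr fun y _ => ?_
    have := dim_add_finrank_le y
    rw [if_pos (by omega)]
    exact zpow_ne_zero _ hq
  have h1 := congrArg ((matK h N M)⁻¹ *ᵥ ·) (matK_mulVec_of_mem_grade hH hh hv)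
  simp only [Matrix.mulVec_mulVec, Matrix.nonsing_inv_mul _ hu, Matrix.one_mulVec,
    Matrix.mulVec_smul] at h1
  rw [eq_inv_smul_iff₀ (zpow_ne_zero _ hq), ← h1]

/-! ### Lowest vectors and the action of `T` on their `R`-strings -/

/-- The coefficients in `L R^i v = x_i R^(i-1) v` for an eigenvector `v` of `L R` in the lowest
degree `r` of a module. -/
noncomputable def loweringCoeff (q : ℂ) (k : ℤ) (x : ℂ) : ℕ → ℂ
  | 0 => 0
  | 1 => x
  | i + 2 => (q + 1) * loweringCoeff q k x (i + 1) - q * loweringCoeff q k x i -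
      (q + 1) * q ^ (k - (i + 1 : ℕ))

/-- The inhomogeneous term cancels in the difference, leaving the recurrence with characteristic
roots `1` and `q` and initial values `0` and `x - x'`. -/
theorem loweringCoeff_sub (q : ℂ) (k : ℤ) (x x' : ℂ) (n : ℕ) :
    loweringCoeff q k x n - loweringCoeff q k x' n = (∑ j ∈ Finset.range n, q ^ j) * (x - x') := by
  induction n using Nat.twoStepInduction with
  | zero => simp [loweringCoeff]
  | one => simp [loweringCoeff]
  | more n h1 h2 =>
    have h3 : ∑ j ∈ Finset.range (n + 2), q ^ j =
        (q + 1) * ∑ j ∈ Finset.range (n + 1), q ^ j - q * ∑ j ∈ Finset.range n, q ^ j := by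
      rw [Finset.sum_range_succ _ (n + 1), Finset.sum_range_succ]
      ring
    rw [h3, loweringCoeff, loweringCoeff]
    linear_combination (q + 1) * h2 - q * h1

/-- A generating vector in the lowest degree `r` of an irreducible module of diameter `d`, with
`L R v = x v`. -/
structure IsLowestVector (h : Submodule F H) (r d : ℕ) (x : ℂ) (v : AttenuatedSpace h → ℂ) :
    Prop where
  mem_grade : v ∈ grade h r
  lowering_eq_zero : lowering h *ᵥ v = 0
  lowering_raising : lowering h *ᵥ (raising h *ᵥ v) = x • v
  pow_eq_zero_iff : ∀ i, raising h ^ i *ᵥ v = 0 ↔ d < i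

namespace IsLowestVector

/-- The two statements are proved together because the relation expresses `L R^(i+2) v` through both
`R L R^(i+1) v` and `R R L R^i v`. The form `R L R^i v` avoids `R^(i-1)` and covers `i = 0`, where
the coefficient is `0` because `L v = 0`. -/
theorem lowering_pow {N M : ℕ} (hH : Module.finrank F H = N + M)
    (hh : Module.finrank F h = M) {r d : ℕ} {x : ℂ} {v : AttenuatedSpace h → ℂ}
    (hv : IsLowestVector h r d x v) (i : ℕ) :
    raising h *ᵥ (lowering h *ᵥ (raising h ^ i *ᵥ v)) =
        loweringCoeff (Nat.card F) ((N : ℤ) + M - r) x i • (raising h ^ i *ᵥ v) ∧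
      lowering h *ᵥ (raising h ^ (i + 1) *ᵥ v) =
        loweringCoeff (Nat.card F) ((N : ℤ) + M - r) x (i + 1) • (raising h ^ i *ᵥ v) := by
  induction i with
  | zero => simp [hv.lowering_eq_zero, hv.lowering_raising, loweringCoeff]
  | succ i ih =>
    constructor
    · rw [ih.2, Matrix.mulVec_smul, raising_pow_mulVec_succ]
    · have hK := matK_mulVec_of_mem_grade hH hh (raising_pow_mulVec_mem_grade hv.mem_grade (i + 1))
      have hk : (N : ℤ) + M - r - (i + 1 : ℕ) = (N : ℤ) + M - (r + (i + 1) : ℕ) := by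
        push_cast
        ring
      rw [raising_pow_mulVec_succ, raising_pow_mulVec_succ, raising_lowering_relation hH hh,
        ← raising_pow_mulVec_succ, ih.2, ih.1, hK, loweringCoeff, hk]
      simp only [Matrix.mulVec_smul, ← raising_pow_mulVec_succ, smul_smul, sub_smul]

/-- The string stops exactly after `R^d v`, so the coefficient with index `d + 1` is zero for both
eigenvalues; by `loweringCoeff_sub` their difference is killed by `1 + q + ... + q^d`. -/
theorem eigenvalue_unique {N M : ℕ} (hH : Module.finrank F H = N + M)
    (hh : Module.finrank F h = M) {r d : ℕ} {x x' : ℂ} {v v' : AttenuatedSpace h → ℂ}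
    (hv : IsLowestVector h r d x v) (hv' : IsLowestVector h r d x' v') : x = x' := by
  have key : ∀ {y : ℂ} {w : AttenuatedSpace h → ℂ}, IsLowestVector h r d y w →
      loweringCoeff (Nat.card F) ((N : ℤ) + M - r) y (d + 1) = 0 := by
    intro y w hw
    have h1 := (hw.lowering_pow hH hh d).2
    rw [(hw.pow_eq_zero_iff (d + 1)).mpr (Nat.lt_succ_self d), Matrix.mulVec_zero] at h1
    exact (smul_eq_zero.mp h1.symm).resolve_right
      fun h2 => lt_irrefl d ((hw.pow_eq_zero_iff d).mp h2)
  have h1 := loweringCoeff_sub (Nat.card F) ((N : ℤ) + M - r) x x' (d + 1)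
  rw [key hv, key hv', sub_self] at h1
  have h2 : ∑ j ∈ Finset.range (d + 1), (Nat.card F : ℂ) ^ j ≠ 0 := by
    have h3 : 0 < ∑ j ∈ Finset.range (d + 1), Nat.card F ^ j :=
      Finset.sum_pos (fun j _ => pow_pos Nat.card_pos j) ⟨0, by simp⟩
    exact_mod_cast h3.ne'
  exact sub_eq_zero.mp ((mul_eq_zero.mp h1.symm).resolve_left h2)

/-- `T` acts in the same way on the vectors `R^i v` and `R^i v'`. -/
theorem mulVec_mem_span {N M : ℕ} (hH : Module.finrank F H = N + M)
    (hh : Module.finrank F h = M) {r d : ℕ} {x : ℂ} {v v' : AttenuatedSpace h → ℂ}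
    (hv : IsLowestVector h r d x v) (hv' : IsLowestVector h r d x v')
    (A : Matrix (AttenuatedSpace h) (AttenuatedSpace h) ℂ) (hA : A ∈ incidenceAlgebra h N M) :
    ∀ u ∈ Submodule.span ℂ (Set.range fun i : ℕ => (raising h ^ i *ᵥ v, raising h ^ i *ᵥ v')),
      (A *ᵥ u.1, A *ᵥ u.2) ∈
        Submodule.span ℂ (Set.range fun i : ℕ => (raising h ^ i *ᵥ v, raising h ^ i *ᵥ v')) := by
  -- Working with pairs forces the same coefficients to appear on both strings; `U` is shown to be
  -- stable under the diagonal action of the generators of `T`.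
  set U := Submodule.span ℂ (Set.range fun i : ℕ => (raising h ^ i *ᵥ v, raising h ^ i *ᵥ v'))
  have hU : ∀ i : ℕ, (raising h ^ i *ᵥ v, raising h ^ i *ᵥ v') ∈ U := fun i =>
    Submodule.subset_span ⟨i, rfl⟩
  have hgen : ∀ B : Matrix (AttenuatedSpace h) (AttenuatedSpace h) ℂ,
      (∀ i : ℕ, (B *ᵥ (raising h ^ i *ᵥ v), B *ᵥ (raising h ^ i *ᵥ v')) ∈ U) →
      ∀ u ∈ U, (B *ᵥ u.1, B *ᵥ u.2) ∈ U := by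
    intro B hB u hu
    induction hu using Submodule.span_induction with
    | mem u hu =>
      obtain ⟨i, rfl⟩ := hu
      exact hB i
    | zero =>
      rw [Prod.fst_zero, Prod.snd_zero, Matrix.mulVec_zero]
      exact U.zero_mem
    | add u w _ _ hu hw =>
      simpa [Matrix.mulVec_add] using U.add_mem hu hw
    | smul c u _ hu =>
      simpa [Matrix.mulVec_smul] using U.smul_mem c hu
  induction hA using Algebra.adjoin_induction with
  | mem B hB =>
    refine hgen B fun i => ?_
    rcases hB with rfl | rfl | rfl | rfl
    · rw [← raising_pow_mulVec_succ, ← raising_pow_mulVec_succ]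
      exact hU (i + 1)
    · cases i with
      | zero =>
        rw [pow_zero, Matrix.one_mulVec, Matrix.one_mulVec, hv.lowering_eq_zero,
          hv'.lowering_eq_zero]
        exact U.zero_mem
      | succ i =>
        rw [(hv.lowering_pow hH hh i).2, (hv'.lowering_pow hH hh i).2]
        exact U.smul_mem _ (hU i)
    · rw [matK_mulVec_of_mem_grade hH hh (raising_pow_mulVec_mem_grade hv.mem_grade i),
        matK_mulVec_of_mem_grade hH hh (raising_pow_mulVec_mem_grade hv'.mem_grade i)]
      exact U.smul_mem _ (hU i)
    · rw [matK_inv_mulVec_of_mem_grade hH hh (raising_pow_mulVec_mem_grade hv.mem_grade i),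
        matK_inv_mulVec_of_mem_grade hH hh (raising_pow_mulVec_mem_grade hv'.mem_grade i)]
      exact U.smul_mem _ (hU i)
  | algebraMap c =>
    intro u hu
    rw [Algebra.algebraMap_eq_smul_one, Matrix.smul_mulVec, Matrix.smul_mulVec, Matrix.one_mulVec,
      Matrix.one_mulVec]
    exact U.smul_mem c hu
  | add B C _ _ hB hC =>
    intro u hu
    simpa [Matrix.add_mulVec] using U.add_mem (hB u hu) (hC u hu)
  | mul B C _ _ hB hC =>
    intro u hu
    simpa using hB _ (hC u hu)

/-- An element of `T` maps `v` and `v'` to the same linear combination of the `R^i v` and the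
`R^i v'`. -/
theorem exists_finsupp {N M : ℕ} (hH : Module.finrank F H = N + M)
    (hh : Module.finrank F h = M) {r d : ℕ} {x : ℂ} {v v' : AttenuatedSpace h → ℂ}
    (hv : IsLowestVector h r d x v) (hv' : IsLowestVector h r d x v')
    (A : Matrix (AttenuatedSpace h) (AttenuatedSpace h) ℂ) (hA : A ∈ incidenceAlgebra h N M) :
    ∃ c : ℕ →₀ ℂ, (A *ᵥ v = c.sum fun i a => a • (raising h ^ i *ᵥ v)) ∧
      A *ᵥ v' = c.sum fun i a => a • (raising h ^ i *ᵥ v') := by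
  have h1 := mulVec_mem_span hH hh hv hv' A hA (v, v') (Submodule.subset_span ⟨0, by simp⟩)
  obtain ⟨c, hc⟩ := (Finsupp.mem_span_range_iff_exists_finsupp).mp h1
  refine ⟨c, ?_, ?_⟩
  · have := congrArg Prod.fst hc
    simpa [Finsupp.sum, Prod.fst_sum] using this.symm
  · have := congrArg Prod.snd hc
    simpa [Finsupp.sum, Prod.snd_sum] using this.symm

/-- The vectors `R^j v` have different degrees, so a coordinate of dimension `r + i` sees only the
`i`th term. -/
theorem sum_apply {r d : ℕ} {x : ℂ} {v : AttenuatedSpace h → ℂ}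
    (hv : IsLowestVector h r d x v) (c : ℕ →₀ ℂ) {y : AttenuatedSpace h} {i : ℕ}
    (hy : dim y = r + i) :
    (c.sum fun i a => a • (raising h ^ i *ᵥ v)) y = c i * (raising h ^ i *ᵥ v) y := by
  rw [Finsupp.sum, Finset.sum_apply, Finset.sum_eq_single i]
  · rfl
  · intro j _ hj
    rw [Pi.smul_apply, raising_pow_mulVec_mem_grade hv.mem_grade j y (by omega), smul_zero]
  · intro hi
    rw [Finsupp.notMem_support_iff.mp hi, zero_smul, Pi.zero_apply]

theorem sum_apply_of_lt {r d : ℕ} {x : ℂ} {v : AttenuatedSpace h → ℂ}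
    (hv : IsLowestVector h r d x v) (c : ℕ →₀ ℂ) {y : AttenuatedSpace h} (hy : dim y < r) :
    (c.sum fun i a => a • (raising h ^ i *ᵥ v)) y = 0 := by
  rw [Finsupp.sum, Finset.sum_apply]
  refine Finset.sum_eq_zero fun j _ => ?_
  rw [Pi.smul_apply, raising_pow_mulVec_mem_grade hv.mem_grade j y (by omega), smul_zero]

/-- If `A v = ∑ c_i R^i v` is zero, then `c_i = 0` whenever `R^i v ≠ 0`, that is, for `i ≤ d`. For
`i > d` the terms `R^i v'` vanish because `d` is common to both vectors. -/
theorem mulVec_eq_zero {N M : ℕ} (hH : Module.finrank F H = N + M)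
    (hh : Module.finrank F h = M) {r d : ℕ} {x : ℂ} {v v' : AttenuatedSpace h → ℂ}
    (hv : IsLowestVector h r d x v) (hv' : IsLowestVector h r d x v')
    (A : Matrix (AttenuatedSpace h) (AttenuatedSpace h) ℂ) (hA : A ∈ incidenceAlgebra h N M)
    (h0 : A *ᵥ v = 0) : A *ᵥ v' = 0 := by
  obtain ⟨c, h1, h2⟩ := exists_finsupp hH hh hv hv' A hA
  rw [h2]
  refine Finset.sum_eq_zero fun i _ => smul_eq_zero.mpr ?_
  rw [or_iff_not_imp_right, hv'.pow_eq_zero_iff, ← hv.pow_eq_zero_iff]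
  intro hi
  obtain ⟨y, hy⟩ := Function.ne_iff.mp hi
  have hdim : dim y = r + i := by
    by_contra hne
    exact hy (raising_pow_mulVec_mem_grade hv.mem_grade i y hne)
  have h3 := hv.sum_apply c hdim
  rw [← h1, h0] at h3
  exact (mul_eq_zero.mp h3.symm).resolve_right hy

end IsLowestVector

/-! ### Irreducible modules are determined by endpoint and diameter -/

variable {N M : ℕ}

/-- In the lowest degree where the module is nonzero, `L` acts as zero and `L R` is an endomorphism
of a nonzero finite-dimensional complex space, so it has an eigenvector. The diameter comes from the
nilpotency of `R`. -/
theorem exists_isLowestVector (hH : Module.finrank F H = N + M) (hh : Module.finrank F h = M)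
    (W : Submodule (incidenceAlgebra h N M) (AttenuatedSpace h → ℂ)) (hW : W ≠ ⊥) :
    ∃ r d x, ∃ v ∈ W, IsLowestVector h r d x v := by
  classical
  have hmem : ∀ A ∈ incidenceAlgebra h N M, ∀ w ∈ W, A *ᵥ w ∈ W := fun A hA w hw =>
    W.smul_mem ⟨A, hA⟩ hw
  have hRT : raising h ∈ incidenceAlgebra h N M := Algebra.subset_adjoin (by simp)
  have hLT : lowering h ∈ incidenceAlgebra h N M := Algebra.subset_adjoin (by simp)
  have hex : ∃ i, ∃ w ∈ W, w ∈ grade h i ∧ w ≠ 0 := by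
    obtain ⟨w, hw, hw0⟩ := (Submodule.ne_bot_iff W).mp hW
    obtain ⟨y, hy⟩ := Function.ne_iff.mp hw0
    have := dim_add_finrank_le y
    refine ⟨dim y, proj h (dim y) *ᵥ w,
      hmem _ (proj_mem_incidenceAlgebra h N M _ (by omega)) w hw, proj_mulVec_mem_grade _ w, ?_⟩
    refine Function.ne_iff.mpr ⟨y, ?_⟩
    rw [proj_mulVec_apply, if_pos rfl]
    exact hy
  set r := Nat.find hex with hr
  have hL0 : ∀ w ∈ W, w ∈ grade h r → lowering h *ᵥ w = 0 := by
    intro w hw hwr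
    cases hr' : r with
    | zero =>
      rw [hr'] at hwr
      exact lowering_mulVec_of_mem_grade_zero hwr
    | succ k =>
      rw [hr'] at hwr
      by_contra hne
      have hlt : k < Nat.find hex := by omega
      exact Nat.find_min hex hlt ⟨_, hmem _ hLT w hw, lowering_mulVec_mem_grade hwr, hne⟩
  let E : Submodule ℂ (AttenuatedSpace h → ℂ) := W.restrictScalars ℂ ⊓ grade h r
  have hE : ∀ w ∈ E, (lowering h * raising h).mulVecLin w ∈ E := by
    rintro w ⟨hw, hwr⟩
    rw [Matrix.mulVecLin_apply]
    refine ⟨hmem _ (mul_mem hLT hRT) w hw, ?_⟩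
    rw [← Matrix.mulVec_mulVec]
    exact lowering_mulVec_mem_grade (raising_mulVec_mem_grade hwr)
  have : Nontrivial E := by
    obtain ⟨w, hw, hwr, hw0⟩ := Nat.find_spec hex
    exact ⟨⟨⟨w, hw, hwr⟩, 0, fun h1 => hw0 (congrArg Subtype.val h1)⟩⟩
  obtain ⟨x, hx⟩ := Module.End.exists_eigenvalue (K := ℂ)
    ((lowering h * raising h).mulVecLin.restrict hE)
  obtain ⟨v, hv⟩ := hx.exists_hasEigenvector
  have hv0 : v.1 ≠ 0 := fun h0 => hv.2 (Subtype.ext h0)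
  have hvx : lowering h *ᵥ (raising h *ᵥ v.1) = x • v.1 := by
    have h1 := congrArg Subtype.val hv.apply_eq_smul
    rw [Matrix.mulVec_mulVec]
    exact h1
  have hex2 : ∃ n, raising h ^ n *ᵥ v.1 = 0 :=
    ⟨N + 1, eq_zero_of_mem_grade hH hh (i := r + (N + 1)) (by omega)
      (raising_pow_mulVec_mem_grade v.2.2 _)⟩
  have hpos : Nat.find hex2 ≠ 0 := fun h0 => hv0 (by
    have := Nat.find_spec hex2
    rwa [h0, pow_zero, Matrix.one_mulVec] at this)
  -- The least power of `R` killing `v` is nonzero because `v ≠ 0`; it equals `d + 1`.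
  refine ⟨r, Nat.find hex2 - 1, x, v.1, v.2.1, v.2.2, hL0 _ v.2.1 v.2.2, hvx, fun i => ?_⟩
  constructor
  · intro hi
    have := Nat.find_min' hex2 hi
    omega
  · intro hi
    obtain ⟨k, rfl⟩ := Nat.exists_eq_add_of_le' (show Nat.find hex2 ≤ i by omega)
    rw [pow_add, ← Matrix.mulVec_mulVec, Nat.find_spec hex2, Matrix.mulVec_zero]

theorem IsLowestVector.ne_zero {r d : ℕ} {x : ℂ} {v : AttenuatedSpace h → ℂ}
    (hv : IsLowestVector h r d x v) : v ≠ 0 := by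
  have := (hv.pow_eq_zero_iff 0).not.mpr (Nat.not_lt_zero d)
  rwa [pow_zero, Matrix.one_mulVec] at this

/-- Simplicity makes `W` equal to `T v`, which is spanned by the nonzero vectors `R^i v`, one in
each degree from `r` to `r + d`. The parameters of a lowest vector are therefore the endpoint and
diameter of `W`. -/
theorem support_eq_Icc (hH : Module.finrank F H = N + M) (hh : Module.finrank F h = M)
    (W : Submodule (incidenceAlgebra h N M) (AttenuatedSpace h → ℂ))
    [IsSimpleModule (incidenceAlgebra h N M) W] {r d : ℕ} {x : ℂ} {v : AttenuatedSpace h → ℂ}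
    (hvW : v ∈ W) (hv : IsLowestVector h r d x v) :
    support h N M W = Set.Icc r (r + d) := by
  ext j
  constructor
  · rintro ⟨-, w, hw, hne⟩
    obtain ⟨A, hA⟩ := MatrixAlgebra.exists_smul_eq_of_isSimpleModule W hvW hw hv.ne_zero
    obtain ⟨c, hc, -⟩ := IsLowestVector.exists_finsupp hH hh hv hv A.1 A.2
    replace hc := hA.symm.trans hc
    obtain ⟨y, hy⟩ := Function.ne_iff.mp hne
    rw [proj_mulVec_apply, Pi.zero_apply] at hy
    obtain ⟨rfl, hyw⟩ := ite_ne_right_iff.mp hy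
    have hry : r ≤ dim y := by
      by_contra hlt
      exact hyw (hc ▸ hv.sum_apply_of_lt c (not_le.mp hlt))
    obtain ⟨i, hi⟩ := Nat.exists_eq_add_of_le hry
    refine ⟨hry, ?_⟩
    by_contra hlt
    refine hyw ?_
    rw [hc, hv.sum_apply c hi, (hv.pow_eq_zero_iff i).mpr (by omega), Pi.zero_apply, mul_zero]
  · rintro ⟨hrj, hjd⟩
    obtain ⟨i, rfl⟩ := Nat.exists_eq_add_of_le hrj
    have hne : raising h ^ i *ᵥ v ≠ 0 := (hv.pow_eq_zero_iff i).not.mpr (by omega)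
    have hgr := raising_pow_mulVec_mem_grade hv.mem_grade i
    refine ⟨?_, raising h ^ i *ᵥ v, ?_, ?_⟩
    · by_contra hlt
      exact hne (eq_zero_of_mem_grade hH hh (not_le.mp hlt) hgr)
    · have hRT : raising h ∈ incidenceAlgebra h N M := Algebra.subset_adjoin (by simp)
      exact W.smul_mem ⟨raising h ^ i, pow_mem hRT i⟩ hvW
    · rwa [proj_mulVec_of_mem_grade hgr]

theorem nonempty_linearEquiv (hH : Module.finrank F H = N + M) (hh : Module.finrank F h = M)
    (W W' : Submodule (incidenceAlgebra h N M) (AttenuatedSpace h → ℂ))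
    [IsSimpleModule (incidenceAlgebra h N M) W] [IsSimpleModule (incidenceAlgebra h N M) W']
    {r d : ℕ} {x x' : ℂ} {v v' : AttenuatedSpace h → ℂ} (hvW : v ∈ W) (hvW' : v' ∈ W')
    (hv : IsLowestVector h r d x v) (hv' : IsLowestVector h r d x' v') :
    Nonempty (W ≃ₗ[incidenceAlgebra h N M] W') := by
  obtain rfl := IsLowestVector.eigenvalue_unique hH hh hv hv'
  exact MatrixAlgebra.nonempty_linearEquiv_of_smul_eq_zero_iff W W' hvW hvW' hv.ne_zero hv'.ne_zero
    fun A => ⟨IsLowestVector.mulVec_eq_zero hH hh hv hv' A.1 A.2,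
      IsLowestVector.mulVec_eq_zero hH hh hv' hv A.1 A.2⟩

/-- An irreducible module is determined up to isomorphism by its endpoint and diameter. -/
theorem moduleType_ext (hH : Module.finrank F H = N + M) (hh : Module.finrank F h = M)
    {l m : MatrixAlgebra.ModuleType (incidenceAlgebra h N M)}
    (he : endpoint h N M l = endpoint h N M m) (hd : diameter h N M l = diameter h N M m) :
    l = m := by
  have hcard : ∀ r d : ℕ, (Set.Icc r (r + d)).ncard - 1 = d := fun r d => by
    rw [← Finset.coe_Icc, Set.ncard_coe_finset, Nat.card_Icc]
    omega
  have hinf : ∀ r d : ℕ, sInf (Set.Icc r (r + d)) = r := fun r d =>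
    csInf_Icc (Nat.le_add_right r d)
  induction l using Quotient.inductionOn with
  | h W =>
    induction m using Quotient.inductionOn with
    | h W' =>
      have := W.2
      have := W'.2
      have hne : ∀ U : MatrixAlgebra.IrreducibleModule (incidenceAlgebra h N M), U.1 ≠ ⊥ :=
        fun U => have := U.2; (Submodule.nontrivial_iff_ne_bot).mp
          (IsSimpleModule.nontrivial (incidenceAlgebra h N M) U.1)
      obtain ⟨r, d, x, v, hvW, hv⟩ := exists_isLowestVector hH hh W.1 (hne W)
      obtain ⟨r', d', x', v', hvW', hv'⟩ := exists_isLowestVector hH hh W'.1 (hne W')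
      change sInf (support h N M W.1) = sInf (support h N M W'.1) at he
      change (support h N M W.1).ncard - 1 = (support h N M W'.1).ncard - 1 at hd
      rw [support_eq_Icc hH hh W.1 hvW hv, support_eq_Icc hH hh W'.1 hvW' hv'] at he hd
      rw [hinf, hinf] at he
      rw [hcard, hcard] at hd
      subst he hd
      exact Quotient.sound (nonempty_linearEquiv hH hh W.1 W'.1 hvW hvW' hv hv')

end

end AttenuatedSpace

/-! ### The generators of the center -/

theorem mainTheorem6 {F H : Type*} [Field F] [Finite F] [AddCommGroup H] [Module F H]
    [FiniteDimensional F H] (N M : ℕ) (hN : 0 < N) (hM : 0 < M)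
    (hH : Module.finrank F H = N + M) (h : Submodule F H) (hh : Module.finrank F h = M)
    (s : ℂ) (hs : s ^ 2 = (Nat.card F : ℂ)) :
    Algebra.adjoin ℂ {AttenuatedSpace.Phi h N M, AttenuatedSpace.Omega h N M s} =
      (Subalgebra.center ℂ (AttenuatedSpace.incidenceAlgebra h N M)).map
        (AttenuatedSpace.incidenceAlgebra h N M).val := by
  have hinj : ∀ a b : ℕ, (Nat.card F : ℂ) ^ a = (Nat.card F : ℂ) ^ b → a = b := fun a b hab =>
    Nat.pow_right_injective (Finite.one_lt_card (α := F)) (by exact_mod_cast hab)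
  refine MatrixAlgebra.adjoin_pair_eq_center _ _ _ fun l m he hd => ?_
  refine AttenuatedSpace.moduleType_ext hH hh (hinj _ _ he) (hinj _ _ ?_)
  -- Squaring `s^d = s^d'` gives an equality of powers of `q`, so the choice of square root plays no
  -- role.
  rw [← hs, ← pow_mul, ← pow_mul, mul_comm, pow_mul, hd, ← pow_mul, mul_comm]
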